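/- Let $\mathcal B$ be an exact category in the sense of Quillen (an additive category with a class of kernel–cokernel pairs, called short exact sequences $X\rightarrowtail Y\twoheadrightarrow Z$, closed under isomorphisms, direct sums and direct summands, and satisfying the usual axioms on identities, compositions, pull-backs of deflations and push-outs of inflations), with enough projectives and enough injectives. Let $\mathcal P$ and $\mathcal I$ be the full subcategories of projective and of injective objects. A cotorsion pair on $\mathcal B$ is a pair $(\mathcal U,\mathcal V)$ of full additive subcategories closed under direct summands such that $\operatorname{Ext}^1_{\mathcal B}(U,V)=0$ for all $U\in\mathcal U$, $V\in\mathcal V$, and such that every $B\in\mathcal B$ admits short exact sequences $V_B\rightarrowtail U_B\twoheadrightarrow B$ and $B\rightarrowtail V^B\twoheadrightarrow U^B$ with $U_B,U^B\in\mathcal U$ and $V_B,V^B\in\mathcal V$. A twin cotorsion pair is a pair of cotorsion pairs $(\mathcal S,\mathcal T),(\mathcal U,\mathcal V)$ with $\mathcal S\subseteq\mathcal U$. Put $\mathcal W=\mathcal T\cap\mathcal U$. Let $\mathcal B^+$ be the class of objects $B$ admitting a short exact sequence $V\rightarrowtail W\twoheadrightarrow B$ with $V\in\mathcal V$, $W\in\mathcal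 W$, let $\mathcal B^-$ be the class of objects $B$ admitting a short exact sequence $B\rightarrowtail W\twoheadrightarrow S$ with $W\in\mathcal W$, $S\in\mathcal S$, and let $\mathcal H=\mathcal B^+\cap\mathcal B^-$. The heart is $\underline{\mathcal H}=\mathcal H/\mathcal W$, the full subcategory on the objects of $\mathcal H$ of the quotient $\mathcal B/\mathcal W$ of $\mathcal B$ by the ideal of morphisms factoring through an object of $\mathcal W$. For subcategories $\mathcal B_1,\mathcal B_2$ of $\mathcal B$, $\mathcal B_1*\mathcal B_2$ denotes the class of objects $X$ admitting a short exact sequence $B_1\rightarrowtail X\twoheadrightarrow B_2$ with $B_1\in\mathcal B_1$, $B_2\in\mathcal B_2$. Theorem. Let $(\mathcal S,\mathcal T),(\mathcal U,\mathcal V)$ be a twin cotorsion pair on $\mathcal B$ such that $$(\mathcal U\subseteq\mathcal S*\mathcal T\ \text{ and }\ \mathcal P\subseteq\mathcal W)\quad\text{or}\quad(\mathcal T\subseteq\mathcal U*\mathcal V\ \text{ and }\ \mathcal I\subseteq\mathcal W).$$ Then the heart $\underline{\mathcal H}$ is integral: it is preabelian (additive, and every morphism has a kernel and a cokernel), and for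 every commutative square in $\underline{\mathcal H}$ $$\begin{array}{ccc}A&\xrightarrow{\ \alpha\ }&B\\ {\scriptstyle\beta}\downarrow&&\downarrow{\scriptstyle\gamma}\\ C&\xrightarrow{\ \delta\ }&D\end{array}$$ the following hold: if the square is a pull-back and $\delta$ is an epimorphism, then $\alpha$ is an epimorphism; and if the square is a push-out and $\alpha$ is a monomorphism, then $\delta$ is a monomorphism. -/

import Mathlib

open CategoryTheory CategoryTheory.Limits

universe v u

/-- A Quillen exact structure on an additive category: a class of kernel-cokernel pairs
`X ⟶ Y ⟶ Z` (the short exact sequences), stable under isomorphisms, direct sums and direct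
summands, such that identities are inflations and deflations, inflations and deflations are closed
under composition, deflations admit pullbacks along arbitrary morphisms which are deflations, and
inflations admit pushouts along arbitrary morphisms which are inflations. -/
structure ExactStructure (C : Type u) [Category.{v} C] [Preadditive C]
    [HasZeroObject C] [HasBinaryBiproducts C] where
  /-- `(i, d)` is a short exact sequence. -/
  ShortExact : ∀ {X Y Z : C}, (X ⟶ Y) → (Y ⟶ Z) → Prop
  comp_zero : ∀ {X Y Z : C} {i : X ⟶ Y} {d : Y ⟶ Z}, ShortExact i d → i ≫ d = 0
  isKernel : ∀ {X Y Z : C} {i : X ⟶ Y} {d : Y ⟶ Z} (h : ShortExact i d),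
    Nonempty (IsLimit (KernelFork.ofι i (comp_zero h)))
  isCokernel : ∀ {X Y Z : C} {i : X ⟶ Y} {d : Y ⟶ Z} (h : ShortExact i d),
    Nonempty (IsColimit (CokernelCofork.ofπ d (comp_zero h)))
  of_iso : ∀ {X Y Z X' Y' Z' : C} {i : X ⟶ Y} {d : Y ⟶ Z} {i' : X' ⟶ Y'} {d' : Y' ⟶ Z'}
    (a : X ≅ X') (b : Y ≅ Y') (c : Z ≅ Z'), i ≫ b.hom = a.hom ≫ i' → d ≫ c.hom = b.hom ≫ d' →
    ShortExact i d → ShortExact i' d'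
  directSum : ∀ {X Y Z X' Y' Z' : C} {i : X ⟶ Y} {d : Y ⟶ Z} {i' : X' ⟶ Y'} {d' : Y' ⟶ Z'},
    ShortExact i d → ShortExact i' d' → ShortExact (biprod.map i i') (biprod.map d d')
  directSummand : ∀ {X Y Z X' Y' Z' : C} {i : X ⟶ Y} {d : Y ⟶ Z} {i' : X' ⟶ Y'} {d' : Y' ⟶ Z'},
    ShortExact (biprod.map i i') (biprod.map d d') → ShortExact i d
  id_inflation : ∀ X : C, ∃ (Z : C) (d : X ⟶ Z), ShortExact (𝟙 X) d
  id_deflation : ∀ X : C, ∃ (K : C) (i : K ⟶ X), ShortExact i (𝟙 X)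
  comp_inflation : ∀ {X Y Z : C} (i : X ⟶ Y) (j : Y ⟶ Z),
    (∃ (Q : C) (d : Y ⟶ Q), ShortExact i d) → (∃ (Q : C) (d : Z ⟶ Q), ShortExact j d) →
    ∃ (Q : C) (d : Z ⟶ Q), ShortExact (i ≫ j) d
  comp_deflation : ∀ {X Y Z : C} (d : X ⟶ Y) (e : Y ⟶ Z),
    (∃ (K : C) (i : K ⟶ X), ShortExact i d) → (∃ (K : C) (i : K ⟶ Y), ShortExact i e) →
    ∃ (K : C) (i : K ⟶ X), ShortExact i (d ≫ e)
  pullback_deflation : ∀ {X Y Z Z' : C} {i : X ⟶ Y} {d : Y ⟶ Z}, ShortExact i d →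
    ∀ f : Z' ⟶ Z, ∃ (Y' : C) (f' : Y' ⟶ Y) (d' : Y' ⟶ Z'),
      IsPullback f' d' d f ∧ ∃ (K : C) (j : K ⟶ Y'), ShortExact j d'
  pushout_inflation : ∀ {X Y Z X' : C} {i : X ⟶ Y} {d : Y ⟶ Z}, ShortExact i d →
    ∀ g : X ⟶ X', ∃ (Y' : C) (g' : Y ⟶ Y') (i' : X' ⟶ Y'),
      IsPushout i g g' i' ∧ ∃ (Q : C) (e : Y' ⟶ Q), ShortExact i' e

namespace ExactStructure

variable {C : Type u} [Category.{v} C] [Preadditive C]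
    [HasZeroObject C] [HasBinaryBiproducts C]
  (E : ExactStructure C)

/-- `i` is the first morphism of a short exact sequence. -/
def IsInflation {X Y : C} (i : X ⟶ Y) : Prop := ∃ (Z : C) (d : Y ⟶ Z), E.ShortExact i d

/-- `d` is the second morphism of a short exact sequence. -/
def IsDeflation {Y Z : C} (d : Y ⟶ Z) : Prop := ∃ (X : C) (i : X ⟶ Y), E.ShortExact i d

/-- The class of projective objects: those which lift along all deflations. -/
def projectives : ObjectProperty C := fun P =>
  ∀ ⦃X Y : C⦄ (f : X ⟶ Y), E.IsDeflation f → ∀ g : P ⟶ Y, ∃ h : P ⟶ X, h ≫ f = g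

/-- The class of injective objects: those which extend along all inflations. -/
def injectives : ObjectProperty C := fun I =>
  ∀ ⦃X Y : C⦄ (f : X ⟶ Y), E.IsInflation f → ∀ g : X ⟶ I, ∃ h : Y ⟶ I, f ≫ h = g

/-- Every object is the target of a deflation from a projective object. -/
def EnoughProjectives : Prop :=
  ∀ X : C, ∃ (P : C) (p : P ⟶ X), E.projectives P ∧ E.IsDeflation p

/-- Every object is the source of an inflation into an injective object. -/
def EnoughInjectives : Prop :=
  ∀ X : C, ∃ (I : C) (j : X ⟶ I), E.injectives I ∧ E.IsInflation j

/-- A short exact sequence `A ⟶ mid ⟶ B`, that is, an extension of `B` by `A`. -/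
structure Extension (B A : C) where
  /-- The middle term. -/
  mid : C
  /-- The inflation. -/
  ι : A ⟶ mid
  /-- The deflation. -/
  π : mid ⟶ B
  shortExact : E.ShortExact ι π

/-- Two extensions of `B` by `A` are equivalent if there is an isomorphism of their middle terms
inducing the identity on `A` and on `B`. -/
instance extensionSetoid (B A : C) : Setoid (E.Extension B A) where
  r x y := ∃ e : x.mid ≅ y.mid, x.ι ≫ e.hom = y.ι ∧ e.hom ≫ y.π = x.π
  iseqv :=
    { refl := fun x => ⟨Iso.refl _, by simp, by simp⟩
      symm := by
        rintro x y ⟨e, h₁, h₂⟩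
        exact ⟨e.symm, by simp [← h₁], by simp [← h₂]⟩
      trans := by
        rintro x y z ⟨e, h₁, h₂⟩ ⟨e', h₁', h₂'⟩
        exact ⟨e ≪≫ e', by simp [← h₁', ← h₁], by simp [h₂', h₂]⟩ }

/-- The Yoneda `Ext¹(B, A)`: equivalence classes of extensions of `B` by `A`. -/
def Ext1 (B A : C) : Type (max u v) := Quotient (E.extensionSetoid B A)

/-- `Ext¹(𝒰, 𝒱) = 0`. The set `Ext1 U V` always contains the class of the split extension, which is
the zero of the Baer sum, so that `Ext¹(U, V) = 0` means that it has at most one element. -/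
def Ext1Vanishes (𝒰 𝒱 : ObjectProperty C) : Prop :=
  ∀ U V : C, 𝒰 U → 𝒱 V → Subsingleton (E.Ext1 U V)

/-- `𝒜 * ℬ`: the objects `X` which admit a short exact sequence `A ⟶ X ⟶ B` with `A` in `𝒜` and `B`
in `ℬ`. -/
def star (𝒜 ℬ : ObjectProperty C) : ObjectProperty C := fun X =>
  ∃ (A B : C) (i : A ⟶ X) (d : X ⟶ B), 𝒜 A ∧ ℬ B ∧ E.ShortExact i d

end ExactStructure

section Additive

variable {C : Type u} [Category.{v} C] [Preadditive C] [HasBinaryBiproducts C]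

/-- A full additive subcategory closed under direct summands (hence under isomorphisms). -/
structure IsAdditiveSubcategory (𝒰 : ObjectProperty C) : Prop where
  zero : ∀ Z : C, IsZero Z → 𝒰 Z
  biprod : ∀ X Y : C, 𝒰 X → 𝒰 Y → 𝒰 (X ⊞ Y)
  summand : ∀ X Y Z : C, (Z ≅ X ⊞ Y) → 𝒰 Z → 𝒰 X

/-- Two morphisms are identified modulo `𝒲` if their difference factors through an object
of `𝒲`. -/
def idealRel (𝒲 : ObjectProperty C) : HomRel C := fun X Y f g =>
  ∃ (Z : C) (a : X ⟶ Z) (b : Z ⟶ Y), 𝒲 Z ∧ f - g = a ≫ b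

lemma idealRel_add {𝒲 : ObjectProperty C} (h : IsAdditiveSubcategory 𝒲) {X Y : C}
    (f₁ f₂ g₁ g₂ : X ⟶ Y) (hf : idealRel 𝒲 f₁ f₂) (hg : idealRel 𝒲 g₁ g₂) :
    idealRel 𝒲 (f₁ + g₁) (f₂ + g₂) := by
  obtain ⟨Z, a, b, hZ, e⟩ := hf
  obtain ⟨Z', a', b', hZ', e'⟩ := hg
  refine ⟨Z ⊞ Z', biprod.lift a a', biprod.desc b b', h.biprod _ _ hZ hZ', ?_⟩
  rw [biprod.lift_desc, ← e, ← e']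
  abel

lemma idealRel_congruence [HasZeroObject C] {𝒲 : ObjectProperty C} (h : IsAdditiveSubcategory 𝒲) :
    Congruence (idealRel 𝒲) where
  equivalence :=
    { refl := fun f => ⟨_, 0, 0, h.zero _ (isZero_zero C), by simp⟩
      symm := by
        rintro f g ⟨Z, a, b, hZ, e⟩
        exact ⟨Z, -a, b, hZ, by rw [Preadditive.neg_comp, ← e]; abel⟩
      trans := by
        rintro f g k hfg hgk
        obtain ⟨Z, a, b, hZ, e⟩ := idealRel_add h _ _ _ _ hfg hgk
        exact ⟨Z, a, b, hZ, by rw [← e]; abel⟩ }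
  comp_left := by
    rintro X Y Z f g g' ⟨W, a, b, hW, e⟩
    exact ⟨W, f ≫ a, b, hW, by rw [← Preadditive.comp_sub, e, Category.assoc]⟩
  comp_right := by
    rintro X Y Z f f' g ⟨W, a, b, hW, e⟩
    exact ⟨W, a, b ≫ g, hW, by rw [← Preadditive.sub_comp, e, Category.assoc]⟩

end Additive

/-- A cotorsion pair `(𝒰, 𝒱)`. -/
structure IsCotorsionPair {C : Type u} [Category.{v} C] [Preadditive C]
    [HasZeroObject C] [HasBinaryBiproducts C]
    (E : ExactStructure C) (𝒰 𝒱 : ObjectProperty C) : Prop where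
  additive_left : IsAdditiveSubcategory 𝒰
  additive_right : IsAdditiveSubcategory 𝒱
  ext_vanishes : E.Ext1Vanishes 𝒰 𝒱
  left_approx : ∀ B : C, ∃ (V U : C) (i : V ⟶ U) (d : U ⟶ B), 𝒱 V ∧ 𝒰 U ∧ E.ShortExact i d
  right_approx : ∀ B : C, ∃ (V U : C) (i : B ⟶ V) (d : V ⟶ U), 𝒱 V ∧ 𝒰 U ∧ E.ShortExact i d

/-- A twin cotorsion pair `(𝒮, 𝒯), (𝒰, 𝒱)`: two cotorsion pairs such that `𝒮 ⊆ 𝒰`. -/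
structure TwinCotorsionPair {C : Type u} [Category.{v} C] [Preadditive C]
    [HasZeroObject C] [HasBinaryBiproducts C]
    (E : ExactStructure C) where
  /-- The left class of the first cotorsion pair. -/
  S : ObjectProperty C
  /-- The right class of the first cotorsion pair. -/
  T : ObjectProperty C
  /-- The left class of the second cotorsion pair. -/
  U : ObjectProperty C
  /-- The right class of the second cotorsion pair. -/
  V : ObjectProperty C
  cotorsion_ST : IsCotorsionPair E S T
  cotorsion_UV : IsCotorsionPair E U V
  S_le_U : S ≤ U

namespace TwinCotorsionPair

variable {C : Type u} [Category.{v} C] [Preadditive C]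
    [HasZeroObject C] [HasBinaryBiproducts C]
  {E : ExactStructure C} (t : TwinCotorsionPair E)

/-- `𝒲 = 𝒯 ∩ 𝒰`. -/
def W : ObjectProperty C := fun X => t.T X ∧ t.U X

lemma W_additive : IsAdditiveSubcategory t.W where
  zero Z hZ := ⟨t.cotorsion_ST.additive_right.zero Z hZ, t.cotorsion_UV.additive_left.zero Z hZ⟩
  biprod X Y hX hY := ⟨t.cotorsion_ST.additive_right.biprod X Y hX.1 hY.1,
    t.cotorsion_UV.additive_left.biprod X Y hX.2 hY.2⟩
  summand X Y Z e hZ := ⟨t.cotorsion_ST.additive_right.summand X Y Z e hZ.1,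
    t.cotorsion_UV.additive_left.summand X Y Z e hZ.2⟩

/-- `ℬ⁺`: the objects `B` which admit a short exact sequence `V ⟶ W ⟶ B` with `V` in `𝒱` and `W`
in `𝒲`. -/
def Bplus : ObjectProperty C := fun B =>
  ∃ (V W : C) (i : V ⟶ W) (d : W ⟶ B), t.V V ∧ t.W W ∧ E.ShortExact i d

/-- `ℬ⁻`: the objects `B` which admit a short exact sequence `B ⟶ W ⟶ S` with `W` in `𝒲` and `S`
in `𝒮`. -/
def Bminus : ObjectProperty C := fun B =>
  ∃ (W S : C) (i : B ⟶ W) (d : W ⟶ S), t.W W ∧ t.S S ∧ E.ShortExact i d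

/-- `ℋ = ℬ⁺ ∩ ℬ⁻`. -/
def H : ObjectProperty C := fun B => t.Bplus B ∧ t.Bminus B

/-- The quotient category `ℬ/𝒲`: the objects of `ℬ`, with the morphisms of `ℬ` modulo those which
factor through an object of `𝒲`. -/
abbrev StableCategory : Type u := CategoryTheory.Quotient (idealRel t.W)

instance : Congruence (idealRel t.W) := idealRel_congruence t.W_additive

instance : Preadditive t.StableCategory :=
  CategoryTheory.Quotient.preadditive (idealRel t.W)
    (fun _ _ f₁ f₂ g₁ g₂ hf hg => idealRel_add t.W_additive f₁ f₂ g₁ g₂ hf hg)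

/-- The heart `ℋ/𝒲`: the full subcategory of `ℬ/𝒲` on the objects of `ℋ`. -/
abbrev Heart : Type u :=
  ObjectProperty.FullSubcategory (C := t.StableCategory) (fun X => t.H X.as)

end TwinCotorsionPair

/-- A preabelian category: an additive category with kernels and cokernels. -/
structure IsPreabelian (A : Type u) [Category.{v} A] [Preadditive A] : Prop where
  hasZeroObject : HasZeroObject A
  hasBinaryBiproducts : HasBinaryBiproducts A
  hasKernels : HasKernels A
  hasCokernels : HasCokernels A

/-- A preabelian category in which epimorphisms are stable under pullback. -/
structure IsLeftIntegral (A : Type u) [Category.{v} A] [Preadditive A] : Prop where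
  preabelian : IsPreabelian A
  epi_of_isPullback : ∀ {X Y Z T : A} {α : X ⟶ Y} {β : X ⟶ Z} {γ : Y ⟶ T} {δ : Z ⟶ T},
    IsPullback α β γ δ → Epi δ → Epi α

/-- A preabelian category in which monomorphisms are stable under pushout. -/
structure IsRightIntegral (A : Type u) [Category.{v} A] [Preadditive A] : Prop where
  preabelian : IsPreabelian A
  mono_of_isPushout : ∀ {X Y Z T : A} {α : X ⟶ Y} {β : X ⟶ Z} {γ : Y ⟶ T} {δ : Z ⟶ T},
    IsPushout α β γ δ → Mono α → Mono δ

/-- An integral category: one which is both left and right integral. -/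
structure IsIntegralCategory (A : Type u) [Category.{v} A] [Preadditive A] : Prop where
  left : IsLeftIntegral A
  right : IsRightIntegral A

/-! ### Universal properties in existence form, and opposites of biproducts. -/

section KernelCriteria

variable {C : Type u} [Category.{v} C] [HasZeroMorphisms C]

/-! Everything is computed in `ℬ` modulo the maps that factor through `𝒲` (`Null`). Two facts drive
the calculus: a map into `ℬ⁺` that factors through `𝒰` is null, and so is a map out of `ℬ⁻` that
factors through `𝒯`. To form the cokernel of `f : A ⟶ B` in the heart, push out an inflation `A ⟶ W`
with cokernel in `𝒮` along `f`, then reflect into `ℬ⁺` (`exists_plus`). Kernels are dual.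

For integrality the pull-back itself need not be computed. It suffices to find one square over `γ`
and `δ`, commutative modulo `𝒲`, whose map `x₁` to `B` is epic: `x₁` factors through `α`, so `α` is
epic. Dually for push-outs.

Assume `𝒰 ⊆ 𝒮 * 𝒯`. The core is `exists_weak_pullback`, for an inflation `δ` with cokernel in `𝒰`.
It rests on `exists_factorization_T`, where the hypothesis on `𝒰` enters. An epimorphism `δ` of the
heart reduces to this case: up to a summand in `𝒲` it is an inflation, and a zero cokernel in the
heart forces its cokernel in `ℬ` into `𝒰`. For a monomorphism `α`, a map killed by the weak push-out
is tested on a weak pullback from the same lemma. So one condition gives both halves of integrality,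
and the other condition follows by passing to the opposite twin cotorsion pair. -/

lemma nonempty_isLimit_kernelFork {X Y Z : C} {i : X ⟶ Y} {d : Y ⟶ Z} (w : i ≫ d = 0) [Mono i]
    (h : ∀ {T : C} (f : T ⟶ Y), f ≫ d = 0 → ∃ g : T ⟶ X, g ≫ i = f) :
    Nonempty (IsLimit (KernelFork.ofι i w)) :=
  ⟨KernelFork.IsLimit.ofι' i w fun k hk => ⟨(h k hk).choose, (h k hk).choose_spec⟩⟩

lemma nonempty_isColimit_cokernelCofork {X Y Z : C} {i : X ⟶ Y} {d : Y ⟶ Z} (w : i ≫ d = 0)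
    [Epi d] (h : ∀ {T : C} (f : Y ⟶ T), i ≫ f = 0 → ∃ g : Z ⟶ T, d ≫ g = f) :
    Nonempty (IsColimit (CokernelCofork.ofπ d w)) :=
  ⟨CokernelCofork.IsColimit.ofπ' d w fun k hk => ⟨(h k hk).choose, (h k hk).choose_spec⟩⟩

end KernelCriteria

lemma CategoryTheory.IsPullback.of_exists {C : Type u} [Category.{v} C] {P X Y Z : C}
    {fst : P ⟶ X} {snd : P ⟶ Y} {f : X ⟶ Z} {g : Y ⟶ Z} (w : fst ≫ f = snd ≫ g)
    (ex : ∀ {T : C} (a : T ⟶ X) (b : T ⟶ Y), a ≫ f = b ≫ g → ∃ l : T ⟶ P, l ≫ fst = a ∧ l ≫ snd = b)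
    (uniq : ∀ {T : C} (l l' : T ⟶ P), l ≫ fst = l' ≫ fst → l ≫ snd = l' ≫ snd → l = l') :
    IsPullback fst snd f g :=
  ⟨⟨w⟩, ⟨PullbackCone.IsLimit.mk w (fun s => (ex s.fst s.snd s.condition).choose)
    (fun s => (ex s.fst s.snd s.condition).choose_spec.1)
    (fun s => (ex s.fst s.snd s.condition).choose_spec.2)
    fun s _ h₁ h₂ => uniq _ _
      (h₁.trans (ex s.fst s.snd s.condition).choose_spec.1.symm)
      (h₂.trans (ex s.fst s.snd s.condition).choose_spec.2.symm)⟩⟩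

section BiprodOp

variable {C : Type u} [Category.{v} C] [Preadditive C] [HasBinaryBiproducts C]

/-- The opposite of a biproduct in the opposite category is the biproduct. -/
noncomputable def unopBiprodIso (X Y : Cᵒᵖ) : X.unop ⊞ Y.unop ≅ (X ⊞ Y).unop where
  hom := biprod.desc (biprod.fst : X ⊞ Y ⟶ X).unop (biprod.snd : X ⊞ Y ⟶ Y).unop
  inv := biprod.lift (biprod.inl : X ⟶ X ⊞ Y).unop (biprod.inr : Y ⟶ X ⊞ Y).unop
  hom_inv_id := by
    ext <;> simp [← unop_comp]
  inv_hom_id := by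
    rw [biprod.lift_desc, ← unop_comp, ← unop_comp, ← unop_add, biprod.total, unop_id]

lemma map_unopBiprodIso_hom {X Y X' Y' : Cᵒᵖ} (f : X ⟶ X') (g : Y ⟶ Y') :
    biprod.map f.unop g.unop ≫ (unopBiprodIso X Y).hom =
      (unopBiprodIso X' Y').hom ≫ (biprod.map f g).unop := by
  ext <;> simp [unopBiprodIso, ← unop_comp]

lemma map_unopBiprodIso_inv {X Y X' Y' : Cᵒᵖ} (f : X ⟶ X') (g : Y ⟶ Y') :
    (biprod.map f g).unop ≫ (unopBiprodIso X Y).symm.hom =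
      (unopBiprodIso X' Y').symm.hom ≫ biprod.map f.unop g.unop := by
  rw [Iso.symm_hom, Iso.symm_hom, Iso.comp_inv_eq, Category.assoc, map_unopBiprodIso_hom,
    Iso.inv_hom_id_assoc]

end BiprodOp

/-! ### Short exact sequences and the opposite exact structure. -/

namespace ExactStructure

variable {C : Type u} [Category.{v} C] [Preadditive C]
    [HasZeroObject C] [HasBinaryBiproducts C]
  {E : ExactStructure C}

namespace ShortExact

variable {X Y Z : C} {i : X ⟶ Y} {d : Y ⟶ Z}

lemma zero (h : E.ShortExact i d) : i ≫ d = 0 := E.comp_zero h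

lemma exists_lift (h : E.ShortExact i d) {T : C} (f : T ⟶ Y) (hf : f ≫ d = 0) :
    ∃ g : T ⟶ X, g ≫ i = f := by
  obtain ⟨hl⟩ := E.isKernel h
  exact ⟨_, (KernelFork.IsLimit.lift' hl f hf).2⟩

lemma exists_desc (h : E.ShortExact i d) {T : C} (f : Y ⟶ T) (hf : i ≫ f = 0) :
    ∃ g : Z ⟶ T, d ≫ g = f := by
  obtain ⟨hl⟩ := E.isCokernel h
  exact ⟨_, (CokernelCofork.IsColimit.desc' hl f hf).2⟩

lemma mono (h : E.ShortExact i d) : Mono i := by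
  obtain ⟨hl⟩ := E.isKernel h
  exact mono_of_isLimit_fork hl

lemma epi (h : E.ShortExact i d) : Epi d := by
  obtain ⟨hl⟩ := E.isCokernel h
  exact epi_of_isColimit_cofork hl

end ShortExact

/-- Any two kernels of a deflation are isomorphic, and the class is closed under isomorphism. -/
lemma shortExact_of_isDeflation {X Y Z : C} {i : X ⟶ Y} {d : Y ⟶ Z} (hd : E.IsDeflation d)
    (w : i ≫ d = 0) [Mono i] (h : ∀ {T : C} (f : T ⟶ Y), f ≫ d = 0 → ∃ g : T ⟶ X, g ≫ i = f) :
    E.ShortExact i d := by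
  obtain ⟨K, j, hj⟩ := hd
  obtain ⟨a, ha⟩ := h j hj.zero
  obtain ⟨b, hb⟩ := hj.exists_lift i w
  have := hj.mono
  refine E.of_iso ⟨a, b, by rw [← cancel_mono j]; simp [hb, ha],
    by rw [← cancel_mono i]; simp [hb, ha]⟩ (Iso.refl _) (Iso.refl _) ?_ ?_ hj
  · simp [ha]
  · simp

lemma shortExact_of_isInflation {X Y Z : C} {i : X ⟶ Y} {d : Y ⟶ Z} (hi : E.IsInflation i)
    (w : i ≫ d = 0) [Epi d] (h : ∀ {T : C} (f : Y ⟶ T), i ≫ f = 0 → ∃ g : Z ⟶ T, d ≫ g = f) :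
    E.ShortExact i d := by
  obtain ⟨K, j, hj⟩ := hi
  obtain ⟨a, ha⟩ := h j hj.zero
  obtain ⟨b, hb⟩ := hj.exists_desc d w
  have := hj.epi
  refine E.of_iso (Iso.refl _) (Iso.refl _) ⟨b, a, by rw [← cancel_epi j]; simp [reassoc_of% hb, ha],
    by rw [← cancel_epi d]; simp [hb, reassoc_of% ha]⟩ ?_ ?_ hj
  · simp
  · simp [hb]

variable (E)

lemma shortExact_id_zero (X : C) {Z : C} (hZ : IsZero Z) : E.ShortExact (𝟙 X) (0 : X ⟶ Z) :=
  have : Epi (0 : X ⟶ Z) := ⟨fun _ _ _ => hZ.eq_of_src _ _⟩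
  shortExact_of_isInflation (E.id_inflation X) (by simp)
    fun f hf => ⟨0, by simpa using hf.symm⟩

lemma shortExact_zero_id (X : C) {Z : C} (hZ : IsZero Z) : E.ShortExact (0 : Z ⟶ X) (𝟙 X) :=
  have : Mono (0 : Z ⟶ X) := ⟨fun _ _ _ => hZ.eq_of_tgt _ _⟩
  shortExact_of_isDeflation (E.id_deflation X) (by simp)
    fun f hf => ⟨0, by simpa using hf.symm⟩

lemma shortExact_inl_snd (X Y : C) :
    E.ShortExact (biprod.inl : X ⟶ X ⊞ Y) (biprod.snd : X ⊞ Y ⟶ Y) := by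
  have h := E.directSum (E.shortExact_id_zero X (isZero_zero C))
    (E.shortExact_zero_id Y (isZero_zero C))
  refine E.of_iso ⟨biprod.fst, biprod.inl, ?_, by simp⟩ (Iso.refl _)
    ⟨biprod.snd, biprod.inr, ?_, by simp⟩ ?_ ?_ h
  · ext; simp
  · ext; simp
  · ext <;> simp
  · ext <;> simp

/-- The opposite exact structure. -/
def op : ExactStructure Cᵒᵖ where
  ShortExact i d := E.ShortExact d.unop i.unop
  comp_zero h := Quiver.Hom.unop_inj (E.comp_zero h)
  isKernel {X Y Z i d} h := by
    have := h.epi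
    have : Mono i := unop_epi_iff i |>.1 this
    refine nonempty_isLimit_kernelFork _ fun f hf => ?_
    obtain ⟨g, hg⟩ := h.exists_desc f.unop (Quiver.Hom.op_inj hf)
    exact ⟨g.op, Quiver.Hom.unop_inj hg⟩
  isCokernel {X Y Z i d} h := by
    have := h.mono
    have : Epi d := unop_mono_iff d |>.1 this
    refine nonempty_isColimit_cokernelCofork _ fun f hf => ?_
    obtain ⟨g, hg⟩ := h.exists_lift f.unop (Quiver.Hom.op_inj hf)
    exact ⟨g.op, Quiver.Hom.unop_inj hg⟩
  of_iso a b c h₁ h₂ h := E.of_iso c.symm.unop b.symm.unop a.symm.unop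
    (by
      apply Quiver.Hom.op_inj
      simp [Iso.inv_comp_eq, Iso.eq_comp_inv, ← h₂])
    (by
      apply Quiver.Hom.op_inj
      simp [Iso.inv_comp_eq, Iso.eq_comp_inv, ← h₁]) h
  directSum {X Y Z X' Y' Z' i d i' d'} h h' := by
    exact E.of_iso (unopBiprodIso _ _) (unopBiprodIso _ _) (unopBiprodIso _ _)
      (map_unopBiprodIso_hom _ _) (map_unopBiprodIso_hom _ _) (E.directSum h h')
  directSummand {X Y Z X' Y' Z' i d i' d'} h := by
    exact E.directSummand (E.of_iso (unopBiprodIso _ _).symm (unopBiprodIso _ _).symm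
      (unopBiprodIso _ _).symm (map_unopBiprodIso_inv _ _) (map_unopBiprodIso_inv _ _) h)
  id_inflation X := by
    obtain ⟨K, i, h⟩ := E.id_deflation X.unop
    exact ⟨.op K, i.op, h⟩
  id_deflation X := by
    obtain ⟨K, i, h⟩ := E.id_inflation X.unop
    exact ⟨.op K, i.op, h⟩
  comp_inflation := by
    rintro X Y Z i j ⟨Q, d, h⟩ ⟨Q', d', h'⟩
    obtain ⟨K, k, hk⟩ := E.comp_deflation j.unop i.unop ⟨_, _, h'⟩ ⟨_, _, h⟩
    exact ⟨.op K, k.op, hk⟩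
  comp_deflation := by
    rintro X Y Z i j ⟨Q, d, h⟩ ⟨Q', d', h'⟩
    obtain ⟨K, k, hk⟩ := E.comp_inflation j.unop i.unop ⟨_, _, h'⟩ ⟨_, _, h⟩
    exact ⟨.op K, k.op, hk⟩
  pullback_deflation := by
    intro X Y Z Z' i d h f
    obtain ⟨Y', g', i', sq, Q, e, h'⟩ := E.pushout_inflation h f.unop
    exact ⟨.op Y', g'.op, i'.op, sq.op.flip, .op Q, e.op, h'⟩
  pushout_inflation := by
    intro X Y Z Z' i d h f
    obtain ⟨Y', g', i', sq, Q, e, h'⟩ := E.pullback_deflation h f.unop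
    exact ⟨.op Y', g'.op, i'.op, sq.op.flip, .op Q, e.op, h'⟩

end ExactStructure

/-! ### Pullbacks, pushouts and splittings of short exact sequences. -/

namespace ExactStructure

variable {C : Type u} [Category.{v} C] [Preadditive C]
    [HasZeroObject C] [HasBinaryBiproducts C]
  {E : ExactStructure C}

namespace ShortExact

variable {X Y Z : C} {i : X ⟶ Y} {d : Y ⟶ Z}

lemma op (h : E.ShortExact i d) : E.op.ShortExact d.op i.op := h

lemma isInflation (h : E.ShortExact i d) : E.IsInflation i := ⟨_, _, h⟩

/-- The pullback of a short exact sequence. -/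
lemma pullback (h : E.ShortExact i d) {Y' Z' : C} {f' : Y' ⟶ Y} {d' : Y' ⟶ Z'} {f : Z' ⟶ Z}
    (sq : IsPullback f' d' d f) : ∃ i' : X ⟶ Y', E.ShortExact i' d' ∧ i' ≫ f' = i := by
  obtain ⟨Y₁, f₁, d₁, sq₁, K, j, hj⟩ := E.pullback_deflation h f
  have hd : E.IsDeflation d' := by
    refine ⟨K, j ≫ (sq₁.isoIsPullback _ _ sq).hom, E.of_iso (Iso.refl _)
      (sq₁.isoIsPullback _ _ sq) (Iso.refl _) ?_ ?_ hj⟩ <;> simp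
  have w : i ≫ d = 0 ≫ f := by simp [h.zero]
  refine ⟨sq.lift i 0 w, ?_, sq.lift_fst _ _ _⟩
  have := h.mono
  have : Mono (sq.lift i 0 w) := mono_of_mono_fac (sq.lift_fst i 0 w)
  refine shortExact_of_isDeflation hd (by simp) fun g hg => ?_
  obtain ⟨l, hl⟩ := h.exists_lift (g ≫ f') (by rw [Category.assoc, sq.w, reassoc_of% hg, zero_comp])
  refine ⟨l, sq.hom_ext ?_ ?_⟩ <;> simp [hl, hg]

/-- The pushout of a short exact sequence. -/
lemma pushout (h : E.ShortExact i d) {X' Y' : C} {g : X ⟶ X'} {g' : Y ⟶ Y'} {i' : X' ⟶ Y'}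
    (sq : IsPushout i g g' i') : ∃ d' : Y' ⟶ Z, E.ShortExact i' d' ∧ g' ≫ d' = d := by
  obtain ⟨d', h', e⟩ := h.op.pullback sq.op.flip
  exact ⟨d'.unop, h', Quiver.Hom.op_inj e⟩

lemma exists_pullback (h : E.ShortExact i d) {Z' : C} (f : Z' ⟶ Z) :
    ∃ (Y' : C) (f' : Y' ⟶ Y) (d' : Y' ⟶ Z') (i' : X ⟶ Y'),
      IsPullback f' d' d f ∧ E.ShortExact i' d' ∧ i' ≫ f' = i := by
  obtain ⟨Y', f', d', sq, -⟩ := E.pullback_deflation h f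
  obtain ⟨i', h', e⟩ := h.pullback sq
  exact ⟨Y', f', d', i', sq, h', e⟩

lemma exists_pushout (h : E.ShortExact i d) {X' : C} (g : X ⟶ X') :
    ∃ (Y' : C) (g' : Y ⟶ Y') (i' : X' ⟶ Y') (d' : Y' ⟶ Z),
      IsPushout i g g' i' ∧ E.ShortExact i' d' ∧ g' ≫ d' = d := by
  obtain ⟨Y', g', i', sq, -⟩ := E.pushout_inflation h g
  obtain ⟨d', h', e⟩ := h.pushout sq
  exact ⟨Y', g', i', d', sq, h', e⟩

/-- The map is `d ⊕ 𝟙` followed by `(𝟙, f)`; a shear isomorphism identifies the latter with a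
projection of a biproduct. -/
lemma isDeflation_desc (h : E.ShortExact i d) {Z' : C} (f : Z' ⟶ Z) :
    E.IsDeflation (biprod.desc d f) := by
  have e : biprod.desc d f = biprod.map d (𝟙 Z') ≫ biprod.desc (𝟙 Z) f := by ext <;> simp
  rw [e]
  refine E.comp_deflation _ _ ⟨_, _, E.directSum h (E.shortExact_zero_id Z' (isZero_zero C))⟩
    ⟨Z', biprod.lift (-f) (𝟙 Z'), ?_⟩
  refine E.of_iso (Iso.refl _) ⟨biprod.lift (biprod.snd - biprod.fst ≫ f) biprod.fst,
    biprod.lift biprod.snd (biprod.fst + biprod.snd ≫ f), ?_, ?_⟩ (Iso.refl _) ?_ ?_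
    (E.shortExact_inl_snd Z' Z)
  · ext <;> simp
  · ext <;> simp
  · ext <;> simp
  · ext <;> simp

lemma biprod_of_isPullback (h : E.ShortExact i d) {Y' Z' : C} {f' : Y' ⟶ Y} {d' : Y' ⟶ Z'}
    {f : Z' ⟶ Z} (sq : IsPullback f' d' d f) :
    E.ShortExact (biprod.lift f' d') (biprod.desc d (-f)) := by
  have : Mono (biprod.lift f' d') := ⟨fun a b hab => sq.hom_ext
    (by simpa using hab =≫ biprod.fst) (by simpa using hab =≫ biprod.snd)⟩
  refine shortExact_of_isDeflation (h.isDeflation_desc _) (by simp [sq.w]) fun g hg => ?_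
  have e : (g ≫ biprod.fst) ≫ d = (g ≫ biprod.snd) ≫ f := by
    rw [biprod.desc_eq] at hg
    simpa [add_neg_eq_zero] using hg
  exact ⟨sq.lift (g ≫ biprod.fst) (g ≫ biprod.snd) e, by ext <;> simp⟩

lemma biprod_of_isPushout (h : E.ShortExact i d) {X' Y' : C} {g : X ⟶ X'} {g' : Y ⟶ Y'}
    {i' : X' ⟶ Y'} (sq : IsPushout i g g' i') :
    E.ShortExact (biprod.lift i g) (biprod.desc g' (-i')) := by
  have := h.op.biprod_of_isPullback sq.op.flip
  -- Dualising yields the maps `(i, -g)` and `(g', i')`; negating the second summand moves the sign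
  -- to `i'`.
  let e : (Opposite.op Y ⊞ Opposite.op X').unop ≅ Y ⊞ X' :=
    { hom := biprod.lift (biprod.inl : .op Y ⟶ .op Y ⊞ .op X').unop
        (-(biprod.inr : .op X' ⟶ .op Y ⊞ .op X').unop)
      inv := biprod.desc (biprod.fst : .op Y ⊞ .op X' ⟶ .op Y).unop
        (-(biprod.snd : .op Y ⊞ .op X' ⟶ .op X').unop)
      hom_inv_id := by
        rw [biprod.lift_desc, Preadditive.neg_comp_neg, ← unop_comp, ← unop_comp, ← unop_add,
          biprod.total, unop_id]
      inv_hom_id := by ext <;> simp [← unop_comp] }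
  refine E.of_iso (Iso.refl _) e (Iso.refl _) ?_ ?_ this
  · ext <;> simp [e, ← unop_comp]
  · rw [← Iso.inv_comp_eq]
    ext <;> simp [e, ← unop_comp]

/-- Noether's isomorphism theorem. -/
lemma comp_of_isPushout (h : E.ShortExact i d) {A B Q : C} {j : Y ⟶ A} {e : A ⟶ B}
    (h' : E.ShortExact j e) {g : A ⟶ Q} {k : Z ⟶ Q} (sq : IsPushout j d g k) :
    E.ShortExact (i ≫ j) g := by
  have hz : (i ≫ j) ≫ g = 0 := by rw [Category.assoc, sq.w, ← Category.assoc, h.zero, zero_comp]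
  have := h.epi
  have : Epi g := ⟨fun a b hab => sq.hom_ext hab (by
    rw [← cancel_epi d, ← sq.w_assoc, ← sq.w_assoc, hab])⟩
  refine shortExact_of_isInflation (E.comp_inflation _ _ h.isInflation h'.isInflation) hz
    fun f hf => ?_
  obtain ⟨l, hl⟩ := h.exists_desc (j ≫ f) (by simpa using hf)
  exact ⟨sq.desc f l hl.symm, by simp⟩

lemma comp_of_isPullback (h : E.ShortExact i d) {A B Q : C} {j : A ⟶ Z} {e : Z ⟶ B}
    (h' : E.ShortExact j e) {g : Q ⟶ Y} {k : Q ⟶ A} (sq : IsPullback g k d j) :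
    E.ShortExact g (d ≫ e) :=
  h'.op.comp_of_isPushout h.op sq.op.flip

lemma exists_section (h : E.ShortExact i d) {r : Y ⟶ X} (hr : i ≫ r = 𝟙 X) :
    ∃ s : Z ⟶ Y, s ≫ d = 𝟙 Z ∧ s ≫ r = 0 ∧ r ≫ i + d ≫ s = 𝟙 Y := by
  obtain ⟨s, hs⟩ := h.exists_desc (𝟙 Y - r ≫ i) (by simp [reassoc_of% hr])
  have := h.epi
  refine ⟨s, ?_, ?_, by rw [hs]; abel⟩
  · rw [← cancel_epi d, reassoc_of% hs]
    simp [h.zero]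
  · rw [← cancel_epi d, reassoc_of% hs]
    simp [hr]

lemma exists_retraction (h : E.ShortExact i d) {s : Z ⟶ Y} (hs : s ≫ d = 𝟙 Z) :
    ∃ r : Y ⟶ X, i ≫ r = 𝟙 X ∧ s ≫ r = 0 ∧ r ≫ i + d ≫ s = 𝟙 Y := by
  obtain ⟨r, h₁, h₂, h₃⟩ := h.op.exists_section (r := s.op) (Quiver.Hom.unop_inj hs)
  exact ⟨r.unop, Quiver.Hom.op_inj h₁, Quiver.Hom.op_inj h₂, by
    rw [add_comm]; exact Quiver.Hom.op_inj h₃⟩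

lemma nonempty_iso_of_retraction (h : E.ShortExact i d) {r : Y ⟶ X} (hr : i ≫ r = 𝟙 X) :
    Nonempty (Y ≅ X ⊞ Z) := by
  obtain ⟨s, h₁, h₂, h₃⟩ := h.exists_section hr
  exact ⟨⟨biprod.lift r d, biprod.desc i s, by simp [h₃], by ext <;> simp [h.zero, *]⟩⟩

end ShortExact

end ExactStructure

/-! ### Vanishing of `Ext¹` as splitting, lifting and extension properties. -/

namespace ExactStructure

variable {C : Type u} [Category.{v} C] [Preadditive C]
    [HasZeroObject C] [HasBinaryBiproducts C]
  {E : ExactStructure C} {𝒰 𝒱 : ObjectProperty C}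

lemma Ext1Vanishes.exists_retraction (h : E.Ext1Vanishes 𝒰 𝒱) {X Y Z : C} {i : X ⟶ Y} {d : Y ⟶ Z}
    (hs : E.ShortExact i d) (hX : 𝒱 X) (hZ : 𝒰 Z) : ∃ r : Y ⟶ X, i ≫ r = 𝟙 X := by
  have : Subsingleton (_root_.Quotient (E.extensionSetoid Z X)) := h Z X hZ hX
  obtain ⟨e, h₁, -⟩ := Quotient.exact (Subsingleton.elim
    (Quotient.mk (E.extensionSetoid Z X) ⟨Y, i, d, hs⟩)
    (Quotient.mk (E.extensionSetoid Z X) ⟨_, _, _, E.shortExact_inl_snd X Z⟩))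
  exact ⟨e.hom ≫ biprod.fst, by rw [← Category.assoc, h₁]; simp⟩

lemma ext1Vanishes_of_exists_retraction
    (h : ∀ {X Y Z : C} {i : X ⟶ Y} {d : Y ⟶ Z}, E.ShortExact i d → 𝒱 X → 𝒰 Z →
      ∃ r : Y ⟶ X, i ≫ r = 𝟙 X) : E.Ext1Vanishes 𝒰 𝒱 := by
  intro U V hU hV
  have key : ∀ x : E.Extension U V, (E.extensionSetoid U V).r x
      ⟨_, _, _, E.shortExact_inl_snd V U⟩ := by
    rintro ⟨Y, i, d, hs⟩
    obtain ⟨r, hr⟩ := h hs hV hU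
    obtain ⟨s, h₁, h₂, h₃⟩ := hs.exists_section hr
    refine ⟨⟨biprod.lift r d, biprod.desc i s, by simp [h₃], by ext <;> simp [hs.zero, *]⟩, ?_, ?_⟩
    · ext <;> simp [hs.zero, hr]
    · simp
  refine ⟨?_⟩
  rintro ⟨x⟩ ⟨y⟩
  exact Quotient.sound ((E.extensionSetoid U V).iseqv.trans (key x)
    ((E.extensionSetoid U V).iseqv.symm (key y)))

lemma Ext1Vanishes.op (h : E.Ext1Vanishes 𝒰 𝒱) : E.op.Ext1Vanishes 𝒱.op 𝒰.op :=
  ext1Vanishes_of_exists_retraction fun {_ _ _ i d} hs hX hZ => by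
    have hs' : E.ShortExact d.unop i.unop := hs
    obtain ⟨r, hr⟩ := h.exists_retraction hs' hZ hX
    obtain ⟨s, h₁, -⟩ := hs'.exists_section hr
    exact ⟨s.op, Quiver.Hom.unop_inj h₁⟩

/-- Morphisms to `𝒱` extend along inflations with cokernel in `𝒰`. -/
lemma Ext1Vanishes.exists_extension (h : E.Ext1Vanishes 𝒰 𝒱) {X Y Z V : C} {i : X ⟶ Y} {d : Y ⟶ Z}
    (hs : E.ShortExact i d) (hZ : 𝒰 Z) (hV : 𝒱 V) (f : X ⟶ V) : ∃ g : Y ⟶ V, i ≫ g = f := by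
  obtain ⟨Y', g', i', d', sq, hs', e⟩ := hs.exists_pushout f
  obtain ⟨r, hr⟩ := h.exists_retraction hs' hV hZ
  exact ⟨g' ≫ r, by rw [sq.w_assoc, hr, Category.comp_id]⟩

/-- Morphisms from `𝒰` lift along deflations with kernel in `𝒱`. -/
lemma Ext1Vanishes.exists_lift (h : E.Ext1Vanishes 𝒰 𝒱) {X Y Z U : C} {i : X ⟶ Y} {d : Y ⟶ Z}
    (hs : E.ShortExact i d) (hX : 𝒱 X) (hU : 𝒰 U) (f : U ⟶ Z) : ∃ g : U ⟶ Y, g ≫ d = f := by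
  obtain ⟨g, hg⟩ := h.op.exists_extension hs.op hX hU f.op
  exact ⟨g.unop, Quiver.Hom.op_inj hg⟩

lemma EnoughProjectives.op (h : E.EnoughProjectives) : E.op.EnoughInjectives := fun X => by
  obtain ⟨P, p, hP, hp⟩ := h X.unop
  refine ⟨.op P, p.op, fun Y Z f hf g => ?_, ?_⟩
  · obtain ⟨K, d, hd⟩ := hf
    obtain ⟨l, hl⟩ := hP f.unop ⟨_, _, hd⟩ g.unop
    exact ⟨l.op, Quiver.Hom.unop_inj hl⟩
  · obtain ⟨K, d, hd⟩ := hp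
    exact ⟨_, _, hd.op⟩

lemma EnoughInjectives.op (h : E.EnoughInjectives) : E.op.EnoughProjectives := fun X => by
  obtain ⟨I, j, hI, hj⟩ := h X.unop
  refine ⟨.op I, j.op, fun Y Z f hf g => ?_, ?_⟩
  · obtain ⟨K, i, hi⟩ := hf
    obtain ⟨l, hl⟩ := hI f.unop ⟨_, _, hi⟩ g.unop
    exact ⟨l.op, Quiver.Hom.unop_inj hl⟩
  · obtain ⟨K, i, hi⟩ := hj
    exact ⟨_, _, hi.op⟩

end ExactStructure

section

variable {C : Type u} [Category.{v} C] [Preadditive C] [HasBinaryBiproducts C]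
  {𝒰 : ObjectProperty C}

lemma IsAdditiveSubcategory.of_iso (h : IsAdditiveSubcategory 𝒰) {X Y : C} (e : X ≅ Y)
    (hX : 𝒰 X) : 𝒰 Y := by
  have hz : 𝒰 (X ⊞ X) := h.biprod _ _ hX hX
  exact h.summand Y X _ (biprod.mapIso e (Iso.refl X)) hz

lemma IsAdditiveSubcategory.op (h : IsAdditiveSubcategory 𝒰) : IsAdditiveSubcategory 𝒰.op where
  zero _ hZ := h.zero _ hZ.unop
  biprod X Y hX hY := h.of_iso (unopBiprodIso X Y) (h.biprod _ _ hX hY)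
  summand X Y Z e hZ := h.summand X.unop Y.unop Z.unop
    (e.unop.symm ≪≫ (unopBiprodIso X Y).symm) hZ

end

/-! ### Closure properties of cotorsion pairs. -/

namespace IsCotorsionPair

variable {C : Type u} [Category.{v} C] [Preadditive C]
    [HasZeroObject C] [HasBinaryBiproducts C]
  {E : ExactStructure C} {𝒰 𝒱 : ObjectProperty C}

lemma op (h : IsCotorsionPair E 𝒰 𝒱) : IsCotorsionPair E.op 𝒱.op 𝒰.op where
  additive_left := h.additive_right.op
  additive_right := h.additive_left.op
  ext_vanishes := h.ext_vanishes.op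
  left_approx B := by
    obtain ⟨V, U, i, d, hV, hU, hs⟩ := h.right_approx B.unop
    exact ⟨.op U, .op V, d.op, i.op, hU, hV, hs⟩
  right_approx B := by
    obtain ⟨V, U, i, d, hV, hU, hs⟩ := h.left_approx B.unop
    exact ⟨.op U, .op V, d.op, i.op, hU, hV, hs⟩

/-- Splitting the approximation `V ⟶ U ⟶ X` makes `X` a direct summand of `U`. -/
lemma left_of_exists_section (h : IsCotorsionPair E 𝒰 𝒱) {X : C}
    (hX : ∀ {V Y : C} {i : V ⟶ Y} {d : Y ⟶ X}, E.ShortExact i d → 𝒱 V → ∃ s : X ⟶ Y, s ≫ d = 𝟙 X) :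
    𝒰 X := by
  obtain ⟨V, U, i, d, hV, hU, hs⟩ := h.left_approx X
  obtain ⟨s, hs'⟩ := hX hs hV
  obtain ⟨r, hr, -⟩ := hs.exists_retraction hs'
  obtain ⟨e⟩ := hs.nonempty_iso_of_retraction hr
  exact h.additive_left.summand X V U (e ≪≫ biprod.braiding _ _) hU

lemma right_of_exists_retraction (h : IsCotorsionPair E 𝒰 𝒱) {X : C}
    (hX : ∀ {U Y : C} {i : X ⟶ Y} {d : Y ⟶ U}, E.ShortExact i d → 𝒰 U → ∃ r : Y ⟶ X, i ≫ r = 𝟙 X) :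
    𝒱 X :=
  h.op.left_of_exists_section (X := .op X) fun {_ _ _ _} hs hV => by
    obtain ⟨r, hr⟩ := hX hs hV
    exact ⟨r.op, Quiver.Hom.unop_inj hr⟩

/-- This replaces the long exact `Ext` sequence by dimension shifting: with `V ⟶ I ⟶ Q` and `I`
injective, an extension of `Y` by `V` is classified by `b : Y ⟶ Q` and splits once `b` lifts to `I`.
The lift is built on `X`, extended to `Y`, and corrected by a lift from `Z`. -/
lemma left_of_extension (h : IsCotorsionPair E 𝒰 𝒱) (hE : E.EnoughInjectives) {X Y Z : C}
    {i : X ⟶ Y} {d : Y ⟶ Z} (hs : E.ShortExact i d) (hX : 𝒰 X) (hZ : 𝒰 Z) : 𝒰 Y := by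
  refine h.left_of_exists_section fun {V A j p} hs' hV => ?_
  obtain ⟨I, k, hI, Q, q, hk⟩ := hE V
  obtain ⟨a, ha⟩ := hI j hs'.isInflation k
  obtain ⟨b, hb⟩ := hs'.exists_desc (a ≫ q) (by rw [reassoc_of% ha, hk.zero])
  obtain ⟨l, hl⟩ := h.ext_vanishes.exists_lift hk hV hX (i ≫ b)
  obtain ⟨l', hl'⟩ := hI i hs.isInflation l
  obtain ⟨c, hc⟩ := hs.exists_desc (b - l' ≫ q) (by
    rw [Preadditive.comp_sub, reassoc_of% hl', hl, sub_self])
  obtain ⟨m, hm⟩ := h.ext_vanishes.exists_lift hk hV hZ c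
  -- `l' + d ≫ m` lifts `b`, so this difference lands in `V`; it is a retraction because `p`
  -- vanishes on `V`.
  obtain ⟨r, hr⟩ := hk.exists_lift (a - p ≫ (l' + d ≫ m)) (by
    simp [hm, hc, hb])
  have := hk.mono
  obtain ⟨s, hs₁, -⟩ := hs'.exists_section (r := r) (by
    rw [← cancel_mono k, Category.assoc, hr, Preadditive.comp_sub, reassoc_of% hs'.zero, ha]
    simp)
  exact ⟨s, hs₁⟩

lemma right_of_extension (h : IsCotorsionPair E 𝒰 𝒱) (hE : E.EnoughProjectives) {X Y Z : C}
    {i : X ⟶ Y} {d : Y ⟶ Z} (hs : E.ShortExact i d) (hX : 𝒱 X) (hZ : 𝒱 Z) : 𝒱 Y :=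
  h.op.left_of_extension hE.op hs.op hZ hX

end IsCotorsionPair

/-! ### Null maps, reflections, and kernels and cokernels modulo `𝒲`. -/

namespace TwinCotorsionPair

variable {C : Type u} [Category.{v} C] [Preadditive C]
    [HasZeroObject C] [HasBinaryBiproducts C]
  {E : ExactStructure C} (t : TwinCotorsionPair E)

/-- `𝒯` contains every object right `Ext¹`-orthogonal to `𝒮`, and `𝒱` is orthogonal to the larger
class `𝒰`. -/
lemma V_le_T : t.V ≤ t.T := fun _ hX =>
  t.cotorsion_ST.right_of_exists_retraction fun {_ _ _ _} hs hU =>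
    t.cotorsion_UV.ext_vanishes.exists_retraction hs hX (t.S_le_U _ hU)

/-- The opposite twin cotorsion pair. -/
def op : TwinCotorsionPair E.op where
  S := t.V.op
  T := t.U.op
  U := t.T.op
  V := t.S.op
  cotorsion_ST := t.cotorsion_UV.op
  cotorsion_UV := t.cotorsion_ST.op
  S_le_U _ hX := t.V_le_T _ hX

lemma W_op {X : Cᵒᵖ} : t.op.W X ↔ t.W X.unop := and_comm

lemma Bplus_op {X : Cᵒᵖ} : t.op.Bplus X ↔ t.Bminus X.unop := by
  constructor
  · rintro ⟨V, W, i, d, hV, hW, hs⟩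
    exact ⟨W.unop, V.unop, d.unop, i.unop, t.W_op.1 hW, hV, hs⟩
  · rintro ⟨W, V, i, d, hW, hV, hs⟩
    exact ⟨.op V, .op W, d.op, i.op, hV, t.W_op.2 hW, hs⟩

lemma Bminus_op {X : Cᵒᵖ} : t.op.Bminus X ↔ t.Bplus X.unop := by
  constructor
  · rintro ⟨V, W, i, d, hV, hW, hs⟩
    exact ⟨W.unop, V.unop, d.unop, i.unop, hW, t.W_op.1 hV, hs⟩
  · rintro ⟨W, V, i, d, hW, hV, hs⟩
    exact ⟨.op V, .op W, d.op, i.op, t.W_op.2 hV, hW, hs⟩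

lemma H_op {X : Cᵒᵖ} : t.op.H X ↔ t.H X.unop :=
  ⟨fun h => ⟨t.Bminus_op.1 h.2, t.Bplus_op.1 h.1⟩, fun h => ⟨t.Bplus_op.2 h.2, t.Bminus_op.2 h.1⟩⟩

/-- The morphisms which factor through an object of `𝒲`. -/
def Null {X Y : C} (f : X ⟶ Y) : Prop := ∃ (Z : C) (a : X ⟶ Z) (b : Z ⟶ Y), t.W Z ∧ f = a ≫ b

variable {t}

namespace Null

variable {X Y Z : C}

lemma comp {f : X ⟶ Y} (hf : t.Null f) (g : Y ⟶ Z) : t.Null (f ≫ g) := by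
  obtain ⟨W, a, b, hW, rfl⟩ := hf
  exact ⟨W, a, b ≫ g, hW, by simp⟩

lemma precomp {g : Y ⟶ Z} (hg : t.Null g) (f : X ⟶ Y) : t.Null (f ≫ g) := by
  obtain ⟨W, a, b, hW, rfl⟩ := hg
  exact ⟨W, f ≫ a, b, hW, by simp⟩

lemma add {f g : X ⟶ Y} (hf : t.Null f) (hg : t.Null g) : t.Null (f + g) := by
  obtain ⟨W, a, b, hW, rfl⟩ := hf
  obtain ⟨W', a', b', hW', rfl⟩ := hg
  exact ⟨W ⊞ W', biprod.lift a a', biprod.desc b b', t.W_additive.biprod _ _ hW hW', by simp⟩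

lemma neg {f : X ⟶ Y} (hf : t.Null f) : t.Null (-f) := by
  obtain ⟨W, a, b, hW, rfl⟩ := hf
  exact ⟨W, -a, b, hW, by simp⟩

lemma sub {f g : X ⟶ Y} (hf : t.Null f) (hg : t.Null g) : t.Null (f - g) := by
  rw [sub_eq_add_neg]
  exact hf.add hg.neg

lemma of_W {W : C} (hW : t.W W) (f : X ⟶ W) (g : W ⟶ Y) : t.Null (f ≫ g) := ⟨W, f, g, hW, rfl⟩

lemma of_add_left {f g : X ⟶ Y} (h : t.Null (f + g)) (hf : t.Null f) : t.Null g := by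
  simpa using h.sub hf

end Null

lemma Null.op {X Y : C} {f : X ⟶ Y} (hf : t.Null f) : t.op.Null f.op := by
  obtain ⟨W, a, b, hW, rfl⟩ := hf
  exact ⟨.op W, b.op, a.op, t.W_op.2 hW, rfl⟩

lemma Null.unop {X Y : Cᵒᵖ} {f : X ⟶ Y} (hf : t.op.Null f) : t.Null f.unop := by
  obtain ⟨W, a, b, hW, rfl⟩ := hf
  exact ⟨W.unop, b.unop, a.unop, t.W_op.1 hW, rfl⟩

lemma exists_lift_of_U {U V Y Z : C} {i : V ⟶ Y} {d : Y ⟶ Z} (hs : E.ShortExact i d) (hV : t.V V)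
    (hU : t.U U) (f : U ⟶ Z) : ∃ g : U ⟶ Y, g ≫ d = f :=
  t.cotorsion_UV.ext_vanishes.exists_lift hs hV hU f

lemma exists_extension_of_T {S T X Y : C} {i : X ⟶ Y} {d : Y ⟶ S} (hs : E.ShortExact i d)
    (hS : t.S S) (hT : t.T T) (f : X ⟶ T) : ∃ g : Y ⟶ T, i ≫ g = f :=
  t.cotorsion_ST.ext_vanishes.exists_extension hs hS hT f

/-- The map `g` lifts to the `𝒲`-term of the sequence witnessing `Y ∈ ℬ⁺`. -/
lemma null_comp_of_U {X U Y : C} (hY : t.Bplus Y) (hU : t.U U) (f : X ⟶ U) (g : U ⟶ Y) :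
    t.Null (f ≫ g) := by
  obtain ⟨V, W, i, d, hV, hW, hs⟩ := hY
  obtain ⟨l, rfl⟩ := exists_lift_of_U hs hV hU g
  exact (Null.of_W hW l d).precomp f

lemma null_comp_of_T {X T Y : C} (hX : t.Bminus X) (hT : t.T T) (f : X ⟶ T) (g : T ⟶ Y) :
    t.Null (f ≫ g) :=
  (null_comp_of_U (t := t.op) (t.Bplus_op.2 hX) (U := .op T) hT g.op f.op).unop

/-- An object of `ℬ⁺` does not see inflations with cokernel in `𝒮`. -/
lemma null_of_null_comp {B Y S Z : C} {i : B ⟶ Y} {d : Y ⟶ S} (hs : E.ShortExact i d) (hS : t.S S)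
    (hZ : t.Bplus Z) {h : Y ⟶ Z} (hi : t.Null (i ≫ h)) : t.Null h := by
  obtain ⟨W, a, b, hW, e⟩ := hi
  obtain ⟨a', ha⟩ := exists_extension_of_T hs hS hW.1 a
  -- Once the null map `a' ≫ b` is removed, the rest factors through `S ∈ 𝒰`, hence is null too.
  obtain ⟨c, hc⟩ := hs.exists_desc (h - a' ≫ b) (by
    rw [Preadditive.comp_sub, e, reassoc_of% ha, sub_self])
  have := (Null.of_W hW a' b).add (null_comp_of_U hZ (t.S_le_U _ hS) d c)
  rw [hc] at this
  simpa using this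

/-- The middle term of the `𝒯`-approximation of `X` is an extension of objects of `𝒰`, so it lies in
`𝒲`. -/
lemma exists_S_coresolution (hI : E.EnoughInjectives) {X : C} (hX : t.U X) :
    ∃ (W S : C) (i : X ⟶ W) (d : W ⟶ S), t.W W ∧ t.S S ∧ E.ShortExact i d := by
  obtain ⟨W, S, i, d, hW, hS, hs⟩ := t.cotorsion_ST.right_approx X
  exact ⟨W, S, i, d, ⟨hW, t.cotorsion_UV.left_of_extension hI hs hX (t.S_le_U _ hS)⟩, hS, hs⟩

lemma Bminus_of_shortExact (hI : E.EnoughInjectives) {X Y S : C} {i : X ⟶ Y} {d : Y ⟶ S} (hs : E.ShortExact i d)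
    (hX : t.Bminus X) (hS : t.S S) : t.Bminus Y := by
  obtain ⟨W₀, S₀, w, e, hW₀, hS₀, hw⟩ := hX
  -- `R` is an extension of `S` by `W₀`, hence in `𝒰`; embedding it in `W₁` gives `Y ⟶ R ⟶ W₁`,
  -- whose cokernel is an extension of `S₁` by `S₀`.
  obtain ⟨R, g, k, d₁, sq, h₁, -⟩ := hw.exists_pushout i
  obtain ⟨d₂, h₂, -⟩ := hs.pushout sq.flip
  obtain ⟨W₁, S₁, j, q, hW₁, hS₁, hj⟩ := exists_S_coresolution hI
    (t.cotorsion_UV.left_of_extension hI h₂ hW₀.2 (t.S_le_U _ hS))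
  obtain ⟨Q, g', i', d', sq', h', -⟩ := hj.exists_pushout d₁
  exact ⟨W₁, Q, k ≫ j, g', hW₁, t.cotorsion_ST.left_of_extension hI h' hS₀ hS₁,
    h₁.comp_of_isPushout hj sq'⟩

variable (t) in
/-- The reflection of an object in `ℬ⁺`. -/
lemma exists_plus (hI : E.EnoughInjectives) (X : C) :
    ∃ (Y S V U : C) (m : X ⟶ Y) (n : Y ⟶ S) (v : V ⟶ U) (p : U ⟶ X),
      t.S S ∧ E.ShortExact m n ∧ t.V V ∧ t.U U ∧ E.ShortExact v p ∧ t.Bplus Y ∧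
      (∀ {Z : C} (h : X ⟶ Z), t.Bplus Z → ∃ g : Y ⟶ Z, m ≫ g = h) ∧
      (∀ {Z : C} (h : Z ⟶ X), t.Null (h ≫ m) → ∃ g : Z ⟶ U, g ≫ p = h) ∧
      (t.Null (𝟙 Y) → t.U X) := by
  obtain ⟨V, U, v, p, hV, hU, hv⟩ := t.cotorsion_UV.left_approx X
  obtain ⟨W, S, j, e, hW, hS, hj⟩ := exists_S_coresolution hI hU
  -- By Noether's theorem the other leg `q` of this pushout has kernel `V`, which puts `Y` in `ℬ⁺`.
  obtain ⟨Y, q, m, n, sq, hm, hqn⟩ := hj.exists_pushout p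
  have hq := hv.comp_of_isPushout hj sq
  refine ⟨Y, S, V, U, m, n, v, p, hS, hm, hV, hU, hv, ⟨V, W, _, q, hV, hW, hq⟩, ?_, ?_, ?_⟩
  · rintro Z h ⟨V', W', i', w, hV', hW', hs'⟩
    obtain ⟨l, hl⟩ := exists_lift_of_U hs' hV' hU (p ≫ h)
    obtain ⟨l', hl'⟩ := exists_extension_of_T hj hS hW'.1 l
    exact ⟨sq.desc (l' ≫ w) h (by rw [reassoc_of% hl', hl]), sq.inr_desc _ _ _⟩
  · rintro Z h ⟨W', a, b, hW', e'⟩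
    -- The null factorization lifts through `q : W ⟶ Y`, and its image in `S` is zero, so it comes
    -- from `U`.
    obtain ⟨b', hb⟩ := exists_lift_of_U hq hV hW'.2 b
    obtain ⟨g, hg⟩ := hj.exists_lift (a ≫ b') (by
      rw [← hqn, Category.assoc, reassoc_of% hb, ← reassoc_of% e', hm.zero, comp_zero])
    have := hm.mono
    refine ⟨g, ?_⟩
    rw [← cancel_mono m, Category.assoc, ← sq.w, reassoc_of% hg, hb, e']
  · rintro ⟨W', a, b, hW', e'⟩
    -- Here `q` acquires a section, so `V` is a retract of `W`, hence of `U`, and `X` is a summand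
    -- of `U`.
    obtain ⟨b', hb⟩ := exists_lift_of_U hq hV hW'.2 b
    obtain ⟨r, hr, -⟩ := hq.exists_retraction (s := a ≫ b') (by rw [Category.assoc, hb, e'])
    obtain ⟨e⟩ := hv.nonempty_iso_of_retraction (r := j ≫ r) (by simpa using hr)
    exact t.cotorsion_UV.additive_left.summand X V U (e ≪≫ biprod.braiding _ _) hU

lemma Bplus_of_shortExact (hP : E.EnoughProjectives) {V X Y : C} {i : V ⟶ Y} {d : Y ⟶ X}
    (hs : E.ShortExact i d) (hX : t.Bplus X) (hV : t.V V) : t.Bplus Y :=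
  t.Bminus_op.1 (Bminus_of_shortExact (t := t.op) hP.op hs.op (t.Bminus_op.2 hX) hV)

variable (t) in
/-- The coreflection of an object in `ℬ⁻`. -/
lemma exists_minus (hP : E.EnoughProjectives) (X : C) :
    ∃ (Y V S T : C) (n : V ⟶ Y) (m : Y ⟶ X) (i : X ⟶ T) (p : T ⟶ S),
      t.V V ∧ E.ShortExact n m ∧ t.T T ∧ t.S S ∧ E.ShortExact i p ∧ t.Bminus Y ∧
      (∀ {Z : C} (h : X ⟶ Z), t.Null (m ≫ h) → ∃ g : T ⟶ Z, i ≫ g = h) := by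
  obtain ⟨Y, S, V, U, m, n, v, p, hS, hm, hV, hU, hv, hY, -, h, -⟩ := t.op.exists_plus hP.op (.op X)
  refine ⟨Y.unop, S.unop, V.unop, U.unop, n.unop, m.unop, p.unop, v.unop, hS, hm, hU, hV, hv,
    t.Bplus_op.1 hY, fun {Z} f hf => ?_⟩
  obtain ⟨g, hg⟩ := h f.op hf.op
  exact ⟨g.unop, Quiver.Hom.op_inj hg⟩

lemma W_le_Bplus {X : C} (hX : t.W X) : t.Bplus X :=
  ⟨_, X, 0, 𝟙 X, t.cotorsion_UV.additive_right.zero _ (isZero_zero C), hX,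
    E.shortExact_zero_id X (isZero_zero C)⟩

lemma W_le_H {X : C} (hX : t.W X) : t.H X :=
  ⟨W_le_Bplus hX, t.Bplus_op.1 (W_le_Bplus (t := t.op) (t.W_op.2 hX))⟩

lemma Bplus_biprod {X Y : C} (hX : t.Bplus X) (hY : t.Bplus Y) : t.Bplus (X ⊞ Y) := by
  obtain ⟨V, W, i, d, hV, hW, hs⟩ := hX
  obtain ⟨V', W', i', d', hV', hW', hs'⟩ := hY
  exact ⟨_, _, _, _, t.cotorsion_UV.additive_right.biprod _ _ hV hV',
    t.W_additive.biprod _ _ hW hW', E.directSum hs hs'⟩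

lemma Bminus_biprod {X Y : C} (hX : t.Bminus X) (hY : t.Bminus Y) : t.Bminus (X ⊞ Y) := by
  obtain ⟨V, W, i, d, hV, hW, hs⟩ := hX
  obtain ⟨V', W', i', d', hV', hW', hs'⟩ := hY
  exact ⟨_, _, _, _, t.W_additive.biprod _ _ hV hV',
    t.cotorsion_ST.additive_left.biprod _ _ hW hW', E.directSum hs hs'⟩

lemma H_biprod {X Y : C} (hX : t.H X) (hY : t.H Y) : t.H (X ⊞ Y) :=
  ⟨Bplus_biprod hX.1 hY.1, Bminus_biprod hX.2 hY.2⟩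

/-- Cokernels in the heart. -/
lemma exists_cokernel (hI : E.EnoughInjectives) {A B : C} (hA : t.H A) (hB : t.H B) (f : A ⟶ B) :
    ∃ (Q : C) (c : B ⟶ Q), t.H Q ∧ t.Null (f ≫ c) ∧
      (∀ {Z : C} (g : B ⟶ Z), t.H Z → t.Null (f ≫ g) → ∃ h : Q ⟶ Z, c ≫ h = g) ∧
      (∀ {Z : C} (h : Q ⟶ Z), t.H Z → t.Null (c ≫ h) → t.Null h) := by
  obtain ⟨W, S, a, b, hW, hS, ha⟩ := hA.2
  -- Any null `f ≫ g` factors through `a`, because maps from `A` to `𝒲` extend along `a`; so `g`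
  -- extends to `M`, and then to its reflection `Q`.
  obtain ⟨M, g', i, e, sq, hi, -⟩ := ha.exists_pushout f
  obtain ⟨Q, S', V, U, m, n, v, p, hS', hm, -, -, -, hQ, ext, -, -⟩ := t.exists_plus hI M
  refine ⟨Q, i ≫ m, ⟨hQ, Bminus_of_shortExact hI hm (Bminus_of_shortExact hI hi hB.2 hS) hS'⟩,
    ?_, ?_, ?_⟩
  · rw [← sq.w_assoc]
    exact Null.of_W hW _ _
  · rintro Z g hZ ⟨W', k, l, hW', e'⟩
    obtain ⟨k', hk⟩ := exists_extension_of_T ha hS hW'.1 k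
    obtain ⟨h, hh⟩ := ext (sq.desc (k' ≫ l) g (by rw [reassoc_of% hk, e'])) hZ.1
    exact ⟨h, by rw [Category.assoc, hh, sq.inr_desc]⟩
  · intro Z h hZ hn
    rw [Category.assoc] at hn
    exact null_of_null_comp hm hS' hZ.1 (null_of_null_comp hi hS hZ.1 hn)

/-- Kernels in the heart. -/
lemma exists_kernel (hP : E.EnoughProjectives) {A B : C} (hA : t.H A) (hB : t.H B) (f : A ⟶ B) :
    ∃ (K : C) (k : K ⟶ A), t.H K ∧ t.Null (k ≫ f) ∧
      (∀ {Z : C} (g : Z ⟶ A), t.H Z → t.Null (g ≫ f) → ∃ h : Z ⟶ K, h ≫ k = g) ∧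
      (∀ {Z : C} (h : Z ⟶ K), t.H Z → t.Null (h ≫ k) → t.Null h) := by
  obtain ⟨K, k, hK, h₁, h₂, h₃⟩ := exists_cokernel (t := t.op) hP.op (t.H_op.2 hB : t.op.H (.op B))
    (t.H_op.2 hA : t.op.H (.op A)) f.op
  refine ⟨K.unop, k.unop, t.H_op.1 hK, h₁.unop, fun g hZ hg => ?_, fun h hZ hh => ?_⟩
  · obtain ⟨h, hh⟩ := h₂ g.op (t.H_op.2 hZ) hg.op
    exact ⟨h.unop, Quiver.Hom.op_inj hh⟩
  · exact (h₃ h.op (t.H_op.2 hZ) hh.op).unop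

end TwinCotorsionPair

/-! ### Weak pullbacks and weak pushouts modulo `𝒲`. -/

namespace TwinCotorsionPair

variable {C : Type u} [Category.{v} C] [Preadditive C]
    [HasZeroObject C] [HasBinaryBiproducts C]
  {E : ExactStructure C} {t : TwinCotorsionPair E}

/-- Factorizations through `𝒯` descend along inflations with cokernel in `𝒰`. -/
lemma exists_factorization_T (hP : E.EnoughProjectives) (hU : t.U ≤ E.star t.S t.T)
    {A Y M Z T : C} {a : A ⟶ Y} {y : Y ⟶ M} (ha : E.ShortExact a y) (hM : t.U M) (hZ : t.Bplus Z)
    (k : Y ⟶ Z) (hT : t.T T) (τ : A ⟶ T) (κ : T ⟶ Z) (e : a ≫ k = τ ≫ κ) :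
    ∃ (T' : C) (τ' : Y ⟶ T') (κ' : T' ⟶ Z), t.T T' ∧ k = τ' ≫ κ' := by
  obtain ⟨S, T₁, s, θ, hS, hT₁, hs⟩ := hU M hM
  -- `F` splits the passage from `A` to `Y` into a step with cokernel `S` and a step with cokernel
  -- `T₁`.
  obtain ⟨F, s', y', a', sq, hF, e₁⟩ := ha.exists_pullback s
  have hF' := ha.comp_of_isPullback hs sq
  obtain ⟨φ, hφ⟩ := exists_extension_of_T hF hS hT τ
  obtain ⟨ψ, hψ⟩ := hF.exists_desc (s' ≫ k - φ ≫ κ) (by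
    rw [Preadditive.comp_sub, reassoc_of% e₁, reassoc_of% hφ, e, sub_self])
  obtain ⟨V, W, i, w, hV, hW, hw⟩ := hZ
  obtain ⟨ψ', rfl⟩ := exists_lift_of_U hw hV (t.S_le_U _ hS) ψ
  -- On `F` the map `k` factors through `T ⊞ W ∈ 𝒯`. Pushing out along `F ⟶ Y` enlarges this to an
  -- extension by `T₁`, which stays in `𝒯`.
  obtain ⟨R, g', i', d', sq', hR, -⟩ := hF'.exists_pushout (biprod.lift φ (y' ≫ ψ'))
  refine ⟨R, g', sq'.desc k (biprod.desc κ w) ?_,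
    t.cotorsion_ST.right_of_extension hP hR
      (t.cotorsion_ST.additive_right.biprod _ _ hT hW.1) hT₁, (sq'.inl_desc _ _ _).symm⟩
  rw [biprod.lift_desc, Category.assoc, hψ]
  abel

/-- A weak pullback along an inflation with cokernel in `𝒰` is epimorphic modulo `𝒲`. -/
lemma exists_weak_pullback (hP : E.EnoughProjectives) (hU : t.U ≤ E.star t.S t.T)
    {B C' D M : C} (hB : t.H B) (hC : t.Bplus C') (hD : t.Bplus D) {δ : C' ⟶ D} {d : D ⟶ M}
    (hδ : E.ShortExact δ d) (hM : t.U M) (γ : B ⟶ D) :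
    ∃ (X : C) (x₁ : X ⟶ B) (x₂ : X ⟶ C'), t.H X ∧ t.Null (x₁ ≫ γ - x₂ ≫ δ) ∧
      ∀ {Q : C} (g : B ⟶ Q), t.Bplus Q → t.Null (x₁ ≫ g) → t.Null g := by
  obtain ⟨V, W, i, w, hV, hW, hw⟩ := hD
  -- Adding `W` turns `γ` into a deflation without changing it modulo `𝒲`; the pullback `A` then
  -- includes into `W ⊞ B` with cokernel `M`.
  obtain ⟨K, j, hj⟩ := hw.isDeflation_desc γ
  obtain ⟨A, a, c, j', sq, -, -⟩ := hj.exists_pullback δ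
  have ha := hj.comp_of_isPullback hδ sq
  have w₀ : (a ≫ biprod.fst) ≫ w + (a ≫ biprod.snd) ≫ γ = c ≫ δ := by
    rw [← sq.w, biprod.desc_eq]
    simp
  -- The same `A` viewed as a pullback of `w`: it is an extension of `B ⊞ C'` by `V`, hence in `ℬ⁺`.
  have sq' : IsPullback (a ≫ biprod.fst) (biprod.lift (a ≫ biprod.snd) c) w
      (biprod.desc (-γ) δ) := by
    refine IsPullback.of_exists ?_ ?_ ?_
    · rw [biprod.lift_desc, ← w₀]
      simp
    · intro T x b hb
      have hb' : biprod.lift x (b ≫ biprod.fst) ≫ biprod.desc w γ = (b ≫ biprod.snd) ≫ δ := by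
        rw [biprod.lift_desc, hb, biprod.desc_eq]
        simp
      refine ⟨sq.lift _ _ hb', by simp, ?_⟩
      ext <;> simp
    · intro T l l' h₁ h₂
      refine sq.hom_ext ?_ ?_
      · ext
        · simpa using h₁
        · simpa using h₂ =≫ biprod.fst
      · simpa using h₂ =≫ biprod.snd
  obtain ⟨i', hi', -⟩ := hw.pullback sq'
  have hA : t.Bplus A := Bplus_of_shortExact hP hi' (Bplus_biprod hB.1 hC) hV
  obtain ⟨X, V', S', T, n, m, k, p, hV', hn, hT, hS', hk, hX, hmin⟩ := t.exists_minus hP A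
  refine ⟨X, m ≫ a ≫ biprod.snd, m ≫ c, ⟨Bplus_of_shortExact hP hn hA hV', hX⟩, ?_, ?_⟩
  · have : (m ≫ a ≫ biprod.snd) ≫ γ - (m ≫ c) ≫ δ = -((m ≫ a ≫ biprod.fst) ≫ w) := by
      rw [Category.assoc m c, ← w₀]
      simp
    rw [this]
    exact (Null.of_W hW _ _).neg
  · intro Q g hQ hg
    -- Vanishing on the coreflection `X` means factoring through `𝒯` on `A`. This descends to `W ⊞
    -- B`, and a map out of `B ∈ ℬ⁻` through `𝒯` is null.
    obtain ⟨κ, hκ⟩ := hmin (a ≫ biprod.snd ≫ g) (by simpa using hg)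
    obtain ⟨T', τ', κ', hT', e⟩ := exists_factorization_T hP hU ha hM hQ (biprod.snd ≫ g) hT k κ
      hκ.symm
    have : g = (biprod.inr ≫ τ') ≫ κ' := by
      rw [Category.assoc, ← e, biprod.inr_snd_assoc]
    rw [this]
    exact null_comp_of_T hB.2 hT' _ _

/-- Epimorphisms of the heart have weak pullbacks which are epimorphisms. -/
lemma exists_weak_pullback_of_epi (hP : E.EnoughProjectives) (hI : E.EnoughInjectives)
    (hU : t.U ≤ E.star t.S t.T)
    {B C' D : C} (hB : t.H B) (hC : t.H C') (hD : t.H D) (γ : B ⟶ D) (δ : C' ⟶ D)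
    (hδ : ∀ {Q : C} (q : D ⟶ Q), t.H Q → t.Null (δ ≫ q) → t.Null q) :
    ∃ (X : C) (x₁ : X ⟶ B) (x₂ : X ⟶ C'), t.H X ∧ t.Null (x₁ ≫ γ - x₂ ≫ δ) ∧
      ∀ {Q : C} (g : B ⟶ Q), t.H Q → t.Null (x₁ ≫ g) → t.Null g := by
  obtain ⟨W, S, c, d, hW, hS, hc⟩ := hC.2
  obtain ⟨M, g', i', e, sq, hi, -⟩ := hc.exists_pushout δ
  -- The reflection of `M` is the cokernel of `δ` in the heart. It is null since `δ` is epic, which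
  -- forces `M` into `𝒰`.
  have hM : t.U M := by
    obtain ⟨Q, S', V, U, m, n, v, p, hS', hm, -, -, -, hQ, -, -, h⟩ := t.exists_plus hI M
    refine h (null_of_null_comp hm hS' hQ (null_of_null_comp hi hS hQ (hδ _ ⟨hQ,
      Bminus_of_shortExact hI hm (Bminus_of_shortExact hI hi hD.2 hS) hS'⟩ ?_)))
    rw [← sq.w_assoc]
    exact Null.of_W hW _ _
  obtain ⟨X, x₁, x₂, hX, h₁, h₂⟩ := exists_weak_pullback hP hU hB hC.1
    (Bplus_biprod (W_le_Bplus hW) hD.1) (hc.biprod_of_isPushout sq) hM (γ ≫ biprod.inr)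
  exact ⟨X, x₁, x₂, hX, by simpa using h₁.comp biprod.snd, fun g hQ hg => h₂ g hQ.1 hg⟩

/-- Monomorphisms of the heart have weak pushouts which are monomorphisms. -/
lemma exists_weak_pushout_of_mono (hP : E.EnoughProjectives) (hI : E.EnoughInjectives)
    (hU : t.U ≤ E.star t.S t.T)
    {A B C' : C} (hA : t.H A) (hB : t.H B) (hC : t.H C') (α : A ⟶ B) (β : A ⟶ C')
    (hα : ∀ {Q : C} (q : Q ⟶ A), t.H Q → t.Null (q ≫ α) → t.Null q) :
    ∃ (D : C) (γ : B ⟶ D) (δ : C' ⟶ D), t.H D ∧ t.Null (α ≫ γ - β ≫ δ) ∧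
      ∀ {Q : C} (q : Q ⟶ C'), t.H Q → t.Null (q ≫ δ) → t.Null q := by
  obtain ⟨W, S, a, d, hW, hS, ha⟩ := hA.2
  obtain ⟨G, g', i', e, sq, hi, -⟩ := ha.exists_pushout (biprod.lift α (-β))
  obtain ⟨D, S', V, U, m, n, v, p, hS', hm, hV, hU', hv, hD, -, hfac, -⟩ := t.exists_plus hI G
  -- `J` makes the cokernel of `A` the object `U ∈ 𝒰` instead of `G`. It is only known to lie in
  -- `ℬ⁺`, which is all that `exists_weak_pullback` asks of its target.
  obtain ⟨J, f', d', i'', sq', hJ, -⟩ := hv.exists_pullback (biprod.desc g' (-i'))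
  obtain ⟨j, hj, ej⟩ := (ha.biprod_of_isPushout sq).pullback sq'.flip
  have hJ' : t.Bplus J := Bplus_of_shortExact hP hJ
    (Bplus_biprod (W_le_Bplus hW) (Bplus_biprod hB.1 hC.1)) hV
  refine ⟨D, biprod.inl ≫ i' ≫ m, biprod.inr ≫ i' ≫ m, ⟨hD, Bminus_of_shortExact hI hm
    (Bminus_of_shortExact hI hi (Bminus_biprod hB.2 hC.2) hS) hS'⟩, ?_, ?_⟩
  · have : α ≫ biprod.inl ≫ i' ≫ m - β ≫ biprod.inr ≫ i' ≫ m = a ≫ g' ≫ m := by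
      rw [sq.w_assoc, biprod.lift_eq]
      simp [sub_eq_add_neg]
    rw [this]
    exact Null.of_W hW _ _
  · intro Q q hQ hq
    obtain ⟨l, hl⟩ := hfac (q ≫ biprod.inr ≫ i') (by simpa using hq)
    -- The sign of `l` offsets that of `-i'`, so `q` and `l` together define a map `Q ⟶ J`.
    have w₀ : (-l) ≫ p = (q ≫ biprod.inr ≫ biprod.inr) ≫ biprod.desc g' (-i') := by
      simp [hl]
    obtain ⟨X, x₁, x₂, hX, h₁, h₂⟩ := exists_weak_pullback hP hU hQ hA.1 hJ' hj hU'
      (sq'.lift _ _ w₀)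
    have h₃ := h₁.comp d'
    rw [Preadditive.sub_comp, Category.assoc, Category.assoc, ej, sq'.lift_snd] at h₃
    -- The `B`-component makes `x₂` null since `α` is monic; the `C'`-component then makes `x₁ ≫ q`
    -- null, and `x₁` cancels.
    have h₄ : t.Null (x₂ ≫ α) := by
      simpa using (h₃.comp (biprod.snd ≫ biprod.fst)).neg
    have h₅ : t.Null (x₁ ≫ q + x₂ ≫ β) := by
      simpa using h₃.comp (biprod.snd ≫ biprod.snd)
    refine h₂ q hC.1 ?_
    rw [add_comm] at h₅
    exact h₅.of_add_left ((hα x₂ hX h₄).comp β)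

end TwinCotorsionPair

/-! ### Passage to the heart, and duality. -/

namespace TwinCotorsionPair

variable {C : Type u} [Category.{v} C] [Preadditive C]
    [HasZeroObject C] [HasBinaryBiproducts C]
  {E : ExactStructure C} {t : TwinCotorsionPair E}

/-- The morphism of the heart induced by a morphism of `ℬ`. -/
def heartMap {X Y : t.Heart} (f : X.obj.as ⟶ Y.obj.as) : X ⟶ Y :=
  ObjectProperty.homMk ((CategoryTheory.Quotient.functor (idealRel t.W)).map f)

lemma heartMap_surjective {X Y : t.Heart} (g : X ⟶ Y) :
    ∃ f : X.obj.as ⟶ Y.obj.as, heartMap f = g := by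
  obtain ⟨g, rfl⟩ := ObjectProperty.homMk_surjective g
  obtain ⟨f, rfl⟩ := (CategoryTheory.Quotient.functor (idealRel t.W)).map_surjective g
  exact ⟨f, rfl⟩

lemma heartMap_comp {X Y Z : t.Heart} (f : X.obj.as ⟶ Y.obj.as) (g : Y.obj.as ⟶ Z.obj.as) :
    heartMap f ≫ heartMap g = (heartMap (f ≫ g) : X ⟶ Z) := rfl

lemma heartMap_id (X : t.Heart) : heartMap (𝟙 X.obj.as) = 𝟙 X := rfl

lemma heartMap_add {X Y : t.Heart} (f g : X.obj.as ⟶ Y.obj.as) :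
    (heartMap (f + g) : X ⟶ Y) = heartMap f + heartMap g := rfl

lemma heartMap_sub {X Y : t.Heart} (f g : X.obj.as ⟶ Y.obj.as) :
    (heartMap (f - g) : X ⟶ Y) = heartMap f - heartMap g := by
  rw [eq_sub_iff_add_eq, ← heartMap_add, sub_add_cancel]

lemma heartMap_zero (X Y : t.Heart) : (heartMap (0 : X.obj.as ⟶ Y.obj.as) : X ⟶ Y) = 0 := rfl

lemma heartMap_eq_zero_iff {X Y : t.Heart} {f : X.obj.as ⟶ Y.obj.as} :
    (heartMap f : X ⟶ Y) = 0 ↔ t.Null f := by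
  rw [← heartMap_zero]
  refine ObjectProperty.hom_ext_iff.trans ?_
  refine (CategoryTheory.Quotient.functor_map_eq_iff (idealRel t.W) f 0).trans ?_
  simp only [idealRel, sub_zero, Null]

variable (t) in
lemma isPreabelian_heart (hP : E.EnoughProjectives) (hI : E.EnoughInjectives) :
    IsPreabelian t.Heart where
  hasZeroObject := by
    obtain ⟨O, hO⟩ : ∃ O : C, IsZero O := HasZeroObject.zero
    have h0 : t.W O := t.W_additive.zero _ hO
    let Z : t.Heart := ⟨⟨O⟩, W_le_H h0⟩
    refine ⟨Z, (IsZero.iff_id_eq_zero Z).2 ?_⟩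
    rw [← heartMap_id, heartMap_eq_zero_iff]
    exact ⟨O, 𝟙 _, 𝟙 _, h0, by simp⟩
  hasBinaryBiproducts := ⟨fun X Y => by
    let b : BinaryBicone X Y :=
      { pt := ⟨⟨X.obj.as ⊞ Y.obj.as⟩, H_biprod X.property Y.property⟩
        fst := heartMap biprod.fst
        snd := heartMap biprod.snd
        inl := heartMap biprod.inl
        inr := heartMap biprod.inr
        inl_fst := by rw [heartMap_comp, biprod.inl_fst, heartMap_id]
        inl_snd := by rw [heartMap_comp, biprod.inl_snd, heartMap_zero]
        inr_fst := by rw [heartMap_comp, biprod.inr_fst, heartMap_zero]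
        inr_snd := by rw [heartMap_comp, biprod.inr_snd, heartMap_id] }
    refine HasBinaryBiproduct.mk ⟨b, isBinaryBilimitOfTotal b ?_⟩
    change heartMap _ ≫ heartMap _ + heartMap _ ≫ heartMap _ = _
    rw [heartMap_comp, heartMap_comp, ← heartMap_add, biprod.total, heartMap_id]⟩
  hasKernels := ⟨fun {X Y} f => by
    obtain ⟨f, rfl⟩ := heartMap_surjective f
    obtain ⟨K, k, hK, h₁, h₂, h₃⟩ := exists_kernel hP X.property Y.property f
    let K' : t.Heart := ⟨⟨K⟩, hK⟩
    let k' : K' ⟶ X := heartMap k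
    have : Mono k' := Preadditive.mono_of_cancel_zero _ fun {Z} g hg => by
      obtain ⟨g, rfl⟩ := heartMap_surjective g
      exact heartMap_eq_zero_iff.2 (h₃ g Z.property (heartMap_eq_zero_iff.1 hg))
    obtain ⟨hl⟩ := nonempty_isLimit_kernelFork (i := k') (d := heartMap f)
      (heartMap_eq_zero_iff.2 h₁) fun {Z} g hg => by
        obtain ⟨g, rfl⟩ := heartMap_surjective g
        obtain ⟨l, hl⟩ := h₂ g Z.property (heartMap_eq_zero_iff.1 hg)
        exact ⟨heartMap l, congrArg heartMap hl⟩
    exact ⟨⟨_, hl⟩⟩⟩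
  hasCokernels := ⟨fun {X Y} f => by
    obtain ⟨f, rfl⟩ := heartMap_surjective f
    obtain ⟨K, k, hK, h₁, h₂, h₃⟩ := exists_cokernel hI X.property Y.property f
    let K' : t.Heart := ⟨⟨K⟩, hK⟩
    let k' : Y ⟶ K' := heartMap k
    have : Epi k' := Preadditive.epi_of_cancel_zero _ fun {Z} g hg => by
      obtain ⟨g, rfl⟩ := heartMap_surjective g
      exact heartMap_eq_zero_iff.2 (h₃ g Z.property (heartMap_eq_zero_iff.1 hg))
    obtain ⟨hl⟩ := nonempty_isColimit_cokernelCofork (i := heartMap f) (d := k')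
      (heartMap_eq_zero_iff.2 h₁) fun {Z} g hg => by
        obtain ⟨g, rfl⟩ := heartMap_surjective g
        obtain ⟨l, hl⟩ := h₂ g Z.property (heartMap_eq_zero_iff.1 hg)
        exact ⟨heartMap l, congrArg heartMap hl⟩
    exact ⟨⟨_, hl⟩⟩⟩

lemma null_of_epi {X Y : t.Heart} {f : X.obj.as ⟶ Y.obj.as} (hf : Epi (heartMap f : X ⟶ Y)) {Q : C}
    (q : Y.obj.as ⟶ Q) (hQ : t.H Q) (hq : t.Null (f ≫ q)) : t.Null q := by
  let Q' : t.Heart := ⟨⟨Q⟩, hQ⟩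
  have : (heartMap q : Y ⟶ Q') = 0 := by
    rw [← cancel_epi (heartMap f : X ⟶ Y), comp_zero]
    exact heartMap_eq_zero_iff.2 hq
  exact heartMap_eq_zero_iff.1 this

lemma null_of_mono {X Y : t.Heart} {f : X.obj.as ⟶ Y.obj.as} (hf : Mono (heartMap f : X ⟶ Y))
    {Q : C} (q : Q ⟶ X.obj.as) (hQ : t.H Q) (hq : t.Null (q ≫ f)) : t.Null q := by
  let Q' : t.Heart := ⟨⟨Q⟩, hQ⟩
  have : (heartMap q : Q' ⟶ X) = 0 := by
    rw [← cancel_mono (heartMap f : X ⟶ Y), zero_comp]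
    exact heartMap_eq_zero_iff.2 hq
  exact heartMap_eq_zero_iff.1 this

/-- The weak pullback maps to the genuine one, so its epic leg factors through `α`. -/
lemma epi_of_isPullback_of_exists {X Y Z T : t.Heart} {α : X ⟶ Y} {β : X ⟶ Z} {γ : Y ⟶ T}
    {δ : Z ⟶ T} (sq : IsPullback α β γ δ) (hδ : Epi δ)
    (h : ∀ {B C' D : C}, t.H B → t.H C' → t.H D → ∀ (γ : B ⟶ D) (δ : C' ⟶ D),
      (∀ {Q : C} (q : D ⟶ Q), t.H Q → t.Null (δ ≫ q) → t.Null q) →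
      ∃ (X : C) (x₁ : X ⟶ B) (x₂ : X ⟶ C'), t.H X ∧ t.Null (x₁ ≫ γ - x₂ ≫ δ) ∧
        ∀ {Q : C} (g : B ⟶ Q), t.H Q → t.Null (x₁ ≫ g) → t.Null g) : Epi α := by
  obtain ⟨γ, rfl⟩ := heartMap_surjective γ
  obtain ⟨δ, rfl⟩ := heartMap_surjective δ
  obtain ⟨P, x₁, x₂, hP, h₁, h₂⟩ := h Y.property Z.property T.property γ δ (null_of_epi hδ)
  let P' : t.Heart := ⟨⟨P⟩, hP⟩
  have w : (heartMap x₁ : P' ⟶ Y) ≫ heartMap γ = (heartMap x₂ : P' ⟶ Z) ≫ heartMap δ := by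
    rw [← sub_eq_zero, heartMap_comp, heartMap_comp, ← heartMap_sub]
    exact heartMap_eq_zero_iff.2 h₁
  refine Preadditive.epi_of_cancel_zero _ fun {Q} g hg => ?_
  obtain ⟨g, rfl⟩ := heartMap_surjective g
  refine heartMap_eq_zero_iff.2 (h₂ g Q.property ?_)
  refine (heartMap_eq_zero_iff (X := P') (Y := Q)).1 ?_
  rw [← heartMap_comp (Y := Y), ← sq.lift_fst _ _ w, Category.assoc, hg, comp_zero]

lemma mono_of_isPushout_of_exists {X Y Z T : t.Heart} {α : X ⟶ Y} {β : X ⟶ Z} {γ : Y ⟶ T}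
    {δ : Z ⟶ T} (sq : IsPushout α β γ δ) (hα : Mono α)
    (h : ∀ {A B C' : C}, t.H A → t.H B → t.H C' → ∀ (α : A ⟶ B) (β : A ⟶ C'),
      (∀ {Q : C} (q : Q ⟶ A), t.H Q → t.Null (q ≫ α) → t.Null q) →
      ∃ (D : C) (γ : B ⟶ D) (δ : C' ⟶ D), t.H D ∧ t.Null (α ≫ γ - β ≫ δ) ∧
        ∀ {Q : C} (q : Q ⟶ C'), t.H Q → t.Null (q ≫ δ) → t.Null q) : Mono δ := by
  obtain ⟨α, rfl⟩ := heartMap_surjective α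
  obtain ⟨β, rfl⟩ := heartMap_surjective β
  obtain ⟨P, x₁, x₂, hP, h₁, h₂⟩ := h X.property Y.property Z.property α β (null_of_mono hα)
  let P' : t.Heart := ⟨⟨P⟩, hP⟩
  have w : heartMap α ≫ (heartMap x₁ : Y ⟶ P') = heartMap β ≫ (heartMap x₂ : Z ⟶ P') := by
    rw [← sub_eq_zero, heartMap_comp, heartMap_comp, ← heartMap_sub]
    exact heartMap_eq_zero_iff.2 h₁
  refine Preadditive.mono_of_cancel_zero _ fun {Q} g hg => ?_
  obtain ⟨g, rfl⟩ := heartMap_surjective g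
  refine heartMap_eq_zero_iff.2 (h₂ g Q.property ?_)
  refine (heartMap_eq_zero_iff (X := Q) (Y := P')).1 ?_
  rw [← heartMap_comp (Y := Z), ← sq.inr_desc _ _ w, reassoc_of% hg, zero_comp]

lemma op_U_le_star (hT : t.T ≤ E.star t.U t.V) : t.op.U ≤ E.op.star t.op.S t.op.T := fun _ hX => by
  obtain ⟨A, B, i, d, hA, hB, hs⟩ := hT _ hX
  exact ⟨.op B, .op A, d.op, i.op, hB, hA, hs⟩

/-- In the opposite category epimorphisms become monomorphisms and `𝒯 ⊆ 𝒰 * 𝒱` becomes the first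
condition, so this is the weak pushout statement there. -/
lemma exists_weak_pullback_of_epi_of_star (hP : E.EnoughProjectives) (hI : E.EnoughInjectives)
    (hT : t.T ≤ E.star t.U t.V)
    {B C' D : C} (hB : t.H B) (hC : t.H C') (hD : t.H D) (γ : B ⟶ D) (δ : C' ⟶ D)
    (hδ : ∀ {Q : C} (q : D ⟶ Q), t.H Q → t.Null (δ ≫ q) → t.Null q) :
    ∃ (X : C) (x₁ : X ⟶ B) (x₂ : X ⟶ C'), t.H X ∧ t.Null (x₁ ≫ γ - x₂ ≫ δ) ∧
      ∀ {Q : C} (g : B ⟶ Q), t.H Q → t.Null (x₁ ≫ g) → t.Null g := by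
  obtain ⟨X, x₁, x₂, hX, h₁, h₂⟩ := exists_weak_pushout_of_mono (t := t.op) hI.op hP.op
    (op_U_le_star hT) (A := .op D) (B := .op C') (C' := .op B) (t.H_op.2 hD) (t.H_op.2 hC)
    (t.H_op.2 hB) δ.op γ.op fun q hQ hq => (hδ q.unop (t.H_op.1 hQ) hq.unop).op
  refine ⟨X.unop, x₂.unop, x₁.unop, t.H_op.1 hX, ?_, fun g hQ hg =>
    (h₂ g.op (t.H_op.2 hQ) hg.op).unop⟩
  simpa using h₁.unop.neg

lemma exists_weak_pushout_of_mono_of_star (hP : E.EnoughProjectives) (hI : E.EnoughInjectives)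
    (hT : t.T ≤ E.star t.U t.V)
    {A B C' : C} (hA : t.H A) (hB : t.H B) (hC : t.H C') (α : A ⟶ B) (β : A ⟶ C')
    (hα : ∀ {Q : C} (q : Q ⟶ A), t.H Q → t.Null (q ≫ α) → t.Null q) :
    ∃ (D : C) (γ : B ⟶ D) (δ : C' ⟶ D), t.H D ∧ t.Null (α ≫ γ - β ≫ δ) ∧
      ∀ {Q : C} (q : Q ⟶ C'), t.H Q → t.Null (q ≫ δ) → t.Null q := by
  obtain ⟨X, x₁, x₂, hX, h₁, h₂⟩ := exists_weak_pullback_of_epi (t := t.op) hI.op hP.op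
    (op_U_le_star hT) (D := .op A) (C' := .op B) (B := .op C') (t.H_op.2 hC) (t.H_op.2 hB)
    (t.H_op.2 hA) β.op α.op fun q hQ hq => (hα q.unop (t.H_op.1 hQ) hq.unop).op
  refine ⟨X.unop, x₂.unop, x₁.unop, t.H_op.1 hX, ?_, fun g hQ hg =>
    (h₂ g.op (t.H_op.2 hQ) hg.op).unop⟩
  simpa using h₁.unop.neg

end TwinCotorsionPair

theorem theorem6 {C : Type u} [Category.{v} C] [Preadditive C]
    [HasZeroObject C] [HasBinaryBiproducts C]
    (E : ExactStructure C) (hP : E.EnoughProjectives) (hI : E.EnoughInjectives)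
    (t : TwinCotorsionPair E)
    (h : (t.U ≤ E.star t.S t.T ∧ E.projectives ≤ t.W) ∨
      (t.T ≤ E.star t.U t.V ∧ E.injectives ≤ t.W)) :
    IsIntegralCategory t.Heart := by
  have hA := t.isPreabelian_heart hP hI
  obtain ⟨h, -⟩ | ⟨h, -⟩ := h
  · exact ⟨⟨hA, fun sq hδ => TwinCotorsionPair.epi_of_isPullback_of_exists sq hδ
      (TwinCotorsionPair.exists_weak_pullback_of_epi hP hI h)⟩,
      ⟨hA, fun sq hα => TwinCotorsionPair.mono_of_isPushout_of_exists sq hα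
      (TwinCotorsionPair.exists_weak_pushout_of_mono hP hI h)⟩⟩
  · exact ⟨⟨hA, fun sq hδ => TwinCotorsionPair.epi_of_isPullback_of_exists sq hδ
      (TwinCotorsionPair.exists_weak_pullback_of_epi_of_star hP hI h)⟩,
      ⟨hA, fun sq hα => TwinCotorsionPair.mono_of_isPushout_of_exists sq hα
      (TwinCotorsionPair.exists_weak_pushout_of_mono_of_star hP hI h)⟩⟩
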